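/- Let $R$ be a commutative artinian ring, $\Lambda$ an artin $R$-algebra (an $R$-algebra that is finitely generated as an $R$-module), $\mathrm{mod}\text{-}\Lambda$ the category of finitely generated right $\Lambda$-modules, and $n\ge 1$ an integer. Modules below are objects of $\mathrm{mod}\text{-}\Lambda$, and subcategories are full. **Definitions.** $\Lambda$ is *Iwanaga–Gorenstein* if it has finite injective dimension both as a right and as a left module over itself. A subcategory $\mathcal C$ of $\mathrm{mod}\text{-}\Lambda$ is *$n$-cluster tilting* if it is functorially finite (every module has a right and a left $\mathcal C$-approximation) and $$\mathcal C=\{X\mid \mathrm{Ext}^i_\Lambda(\mathcal C,X)=0,\ 0<i<n\}=\{X\mid \mathrm{Ext}^i_\Lambda(X,\mathcal C)=0,\ 0<i<n\}.$$ It is *$n\mathbb Z$-cluster tilting* if moreover $\mathrm{Ext}^i_\Lambda(\mathcal C,\mathcal C)=0$ for all $i\notin n\mathbb Z$. For a complex $\cdots\to P^{-1}\to P^0\to P^1\to\cdots$ put $Z^j=\mathrm{Ker}(P^j\to P^{j+1})$. An acyclic complex $P$ of projective modules is *totally acyclic* if $\mathrm{Hom}_\Lambda(P,Q)$ is acyclic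 for every projective module $Q$; $\mathrm{Gprj}\,\Lambda$ is the subcategory of all modules isomorphic to $Z^0$ for such a $P$ (the Gorenstein projective modules). An acyclic complex $P$ of projective modules is *$n\mathbb Z$-totally acyclic* (with respect to $\mathcal C$) if $Z^{in}\in\mathcal C$ for all $i\in\mathbb Z$ and, for every projective module $Q$ and every $i\in\mathbb Z$, applying $\mathrm{Hom}_\Lambda(-,Q)$ to $$0\to Z^{in}\to P^{in}\to P^{in+1}\to\cdots\to P^{(i+1)n-1}\to Z^{(i+1)n}\to 0$$ gives an exact sequence; $n\mathbb Z\text{-}\mathrm{Gprj}\,\mathcal C$ is the subcategory of all modules in $\mathcal C$ isomorphic to $Z^{in}$ for some $i\in\mathbb Z$ and some $n\mathbb Z$-totally acyclic complex. Dually, $\mathrm{Ginj}\,\Lambda$ and $n\mathbb Z\text{-}\mathrm{Ginj}\,\mathcal C$ are defined with acyclic complexes of injective modules and the functors $\mathrm{Hom}_\Lambda(Q,-)$ for injective modules $Q$. $\Omega^k X$ denotes the $k$-th syzygy of $X$ and $\Omega^{-k}X$ the $k$-th cosyzygy; these are determined up to projective, respectively injective, direct summands. An $n\mathbb Z$-cluster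 tilting subcategory $\mathcal C$ is *$n\mathbb Z$-G-cluster tilting* if for every $X\in\mathcal C$ there are integers $i,j\ge 0$ such that $\Omega^{in}X\in n\mathbb Z\text{-}\mathrm{Gprj}\,\mathcal C$ and $\Omega^{-jn}X\in n\mathbb Z\text{-}\mathrm{Ginj}\,\mathcal C$, whichever representatives of the syzygy and cosyzygy are taken. **Proposition.** If $\Lambda$ is Iwanaga–Gorenstein and $\mathcal C$ is an $n\mathbb Z$-cluster tilting subcategory of $\mathrm{mod}\text{-}\Lambda$, then $\mathcal C$ is $n\mathbb Z$-G-cluster tilting. Moreover, $$n\mathbb Z\text{-}\mathrm{Gprj}\,\mathcal C=\mathrm{Gprj}\,\Lambda\cap\mathcal C\qquad\text{and}\qquad n\mathbb Z\text{-}\mathrm{Ginj}\,\mathcal C=\mathrm{Ginj}\,\Lambda\cap\mathcal C .$$ -/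

import Mathlib

open CategoryTheory

universe u

namespace NZGorenstein

variable {S : Type u} [Ring S]

/-! Throughout, `S` is a ring and `ModuleCat S` is the category of left `S`-modules. Right modules
over `Λ` are left modules over `Λᵐᵒᵖ`. A full subcategory of `mod S` (finitely generated modules)
is an `ObjectProperty` of `ModuleCat S` that holds only for finitely generated modules. -/

/-- Finitely generated projective modules. -/
def FGProj (P : ModuleCat.{u} S) : Prop := Module.Finite S P ∧ Projective P

/-- Finitely generated injective modules. -/
def FGInj (I : ModuleCat.{u} S) : Prop := Module.Finite S I ∧ Injective I

/-! ### Cluster tilting subcategories -/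

/-- `C ^ ⊥ₙ`: the finitely generated `X` with `Ext^i(C, X) = 0` for `0 < i < n`. -/
def rightPerp (n : ℕ) (C : ObjectProperty (ModuleCat.{u} S)) : ObjectProperty (ModuleCat.{u} S) :=
  fun X => Module.Finite S X ∧
    ∀ Y, C Y → ∀ i : ℕ, 0 < i → i < n → Subsingleton (Abelian.Ext Y X i)

/-- `⊥ₙ C`: the finitely generated `X` with `Ext^i(X, C) = 0` for `0 < i < n`. -/
def leftPerp (n : ℕ) (C : ObjectProperty (ModuleCat.{u} S)) : ObjectProperty (ModuleCat.{u} S) :=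
  fun X => Module.Finite S X ∧
    ∀ Y, C Y → ∀ i : ℕ, 0 < i → i < n → Subsingleton (Abelian.Ext X Y i)

/-- `C` is functorially finite in `mod S`: every finitely generated module has a right and a left
`C`-approximation. -/
structure IsFunctoriallyFinite (C : ObjectProperty (ModuleCat.{u} S)) : Prop where
  right : ∀ M : ModuleCat.{u} S, Module.Finite S M → ∃ (X : ModuleCat.{u} S) (f : X ⟶ M), C X ∧
    ∀ (Y : ModuleCat.{u} S) (g : Y ⟶ M), C Y → ∃ h : Y ⟶ X, h ≫ f = g
  left : ∀ M : ModuleCat.{u} S, Module.Finite S M → ∃ (X : ModuleCat.{u} S) (f : M ⟶ X), C X ∧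
    ∀ (Y : ModuleCat.{u} S) (g : M ⟶ Y), C Y → ∃ h : X ⟶ Y, f ≫ h = g

/-- `n`-cluster tilting subcategories of `mod S`. (The condition `C = C ^ ⊥ₙ` forces all modules in
`C` to be finitely generated.) -/
structure IsClusterTilting (n : ℕ) (C : ObjectProperty (ModuleCat.{u} S)) : Prop where
  functoriallyFinite : IsFunctoriallyFinite C
  eq_rightPerp : C = rightPerp n C
  eq_leftPerp : C = leftPerp n C

/-- `nℤ`-cluster tilting subcategories of `mod S`: those `n`-cluster tilting subcategories with
`Ext^i(C, C) = 0` for all `i ∉ nℤ`. -/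
structure IsNZClusterTilting (n : ℕ) (C : ObjectProperty (ModuleCat.{u} S)) : Prop
    extends IsClusterTilting n C where
  ext_vanish : ∀ X Y, C X → C Y → ∀ i : ℕ, ¬ n ∣ i → Subsingleton (Abelian.Ext X Y i)

/-! ### Gorenstein projective and Gorenstein injective modules -/

/-- An acyclic complex of finitely generated projective modules such that `Hom(P, Q)` is acyclic
for every (finitely generated) projective module `Q`. -/
structure IsTotallyAcyclicProj (P : CochainComplex (ModuleCat.{u} S) ℤ) : Prop where
  acyclic : P.Acyclic
  fgProj : ∀ j, FGProj (P.X j)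
  hom_exact : ∀ Q : ModuleCat.{u} S, FGProj Q → ∀ (j : ℤ) (f : P.X j ⟶ Q),
    P.d (j - 1) j ≫ f = 0 → ∃ g : P.X (j + 1) ⟶ Q, P.d j (j + 1) ≫ g = f

/-- An acyclic complex of finitely generated injective modules such that `Hom(Q, I)` is acyclic
for every (finitely generated) injective module `Q`. -/
structure IsTotallyAcyclicInj (I : CochainComplex (ModuleCat.{u} S) ℤ) : Prop where
  acyclic : I.Acyclic
  fgInj : ∀ j, FGInj (I.X j)
  hom_exact : ∀ Q : ModuleCat.{u} S, FGInj Q → ∀ (j : ℤ) (f : Q ⟶ I.X j),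
    f ≫ I.d j (j + 1) = 0 → ∃ g : Q ⟶ I.X (j - 1), g ≫ I.d (j - 1) j = f

/-- `Gprj S`: finitely generated Gorenstein projective modules. -/
def Gprj : ObjectProperty (ModuleCat.{u} S) := fun G =>
  ∃ P : CochainComplex (ModuleCat.{u} S) ℤ, IsTotallyAcyclicProj P ∧ Nonempty (G ≅ P.cycles 0)

/-- `Ginj S`: finitely generated Gorenstein injective modules. -/
def Ginj : ObjectProperty (ModuleCat.{u} S) := fun G =>
  ∃ I : CochainComplex (ModuleCat.{u} S) ℤ, IsTotallyAcyclicInj I ∧ Nonempty (G ≅ I.cycles 0)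

/-! ### `nℤ`-Gorenstein projective and `nℤ`-Gorenstein injective modules -/

/-- With `Z^j = Ker (P^j ⟶ P^{j+1})`, the sequence
`0 ⟶ Hom(Z^b, Q) ⟶ Hom(P^{b-1}, Q) ⟶ ⋯ ⟶ Hom(P^a, Q) ⟶ Hom(Z^a, Q) ⟶ 0`
obtained by applying `Hom(-, Q)` to `0 ⟶ Z^a ⟶ P^a ⟶ ⋯ ⟶ P^{b-1} ⟶ Z^b ⟶ 0` is exact (`a < b`). -/
structure SegmentHomToExact (P : CochainComplex (ModuleCat.{u} S) ℤ) (a b : ℤ)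
    (Q : ModuleCat.{u} S) : Prop where
  /-- exactness at `Hom(Z^a, Q)` -/
  exact_first : ∀ f : P.cycles a ⟶ Q, ∃ g : P.X a ⟶ Q, P.iCycles a ≫ g = f
  /-- exactness at `Hom(P^j, Q)` for `a ≤ j < b - 1`; the arrow into `P^j` is `Z^a ⟶ P^a` when
  `j = a` and the differential otherwise -/
  exact_mid : ∀ j : ℤ, a ≤ j → j < b - 1 → ∀ f : P.X j ⟶ Q,
    (j = a → P.iCycles j ≫ f = 0) → (a < j → P.d (j - 1) j ≫ f = 0) →
      ∃ g : P.X (j + 1) ⟶ Q, P.d j (j + 1) ≫ g = f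
  /-- exactness at `Hom(P^{b-1}, Q)` -/
  exact_last : ∀ f : P.X (b - 1) ⟶ Q,
    (b - 1 = a → P.iCycles (b - 1) ≫ f = 0) →
    (a < b - 1 → P.d (b - 1 - 1) (b - 1) ≫ f = 0) →
      ∃ g : P.cycles b ⟶ Q, P.toCycles (b - 1) b ≫ g = f
  /-- exactness at `Hom(Z^b, Q)` -/
  exact_end : ∀ g : P.cycles b ⟶ Q, P.toCycles (b - 1) b ≫ g = 0 → g = 0

/-- With `Z^j = Ker (I^j ⟶ I^{j+1})`, the sequence
`0 ⟶ Hom(Q, Z^a) ⟶ Hom(Q, I^a) ⟶ ⋯ ⟶ Hom(Q, I^{b-1}) ⟶ Hom(Q, Z^b) ⟶ 0`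
obtained by applying `Hom(Q, -)` to `0 ⟶ Z^a ⟶ I^a ⟶ ⋯ ⟶ I^{b-1} ⟶ Z^b ⟶ 0` is exact (`a < b`). -/
structure SegmentHomFromExact (I : CochainComplex (ModuleCat.{u} S) ℤ) (a b : ℤ)
    (Q : ModuleCat.{u} S) : Prop where
  /-- exactness at `Hom(Q, Z^b)` -/
  exact_last : ∀ f : Q ⟶ I.cycles b, ∃ g : Q ⟶ I.X (b - 1), g ≫ I.toCycles (b - 1) b = f
  /-- exactness at `Hom(Q, I^j)` for `a < j < b`; the arrow out of `I^j` is `I^{b-1} ⟶ Z^b` when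
  `j = b - 1` and the differential otherwise -/
  exact_mid : ∀ j : ℤ, a < j → j < b → ∀ f : Q ⟶ I.X j,
    (j = b - 1 → f ≫ I.toCycles j b = 0) → (j < b - 1 → f ≫ I.d j (j + 1) = 0) →
      ∃ g : Q ⟶ I.X (j - 1), g ≫ I.d (j - 1) j = f
  /-- exactness at `Hom(Q, I^a)` -/
  exact_first : ∀ f : Q ⟶ I.X a,
    (a = b - 1 → f ≫ I.toCycles a b = 0) → (a < b - 1 → f ≫ I.d a (a + 1) = 0) →
      ∃ g : Q ⟶ I.cycles a, g ≫ I.iCycles a = f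
  /-- exactness at `Hom(Q, Z^a)` -/
  exact_start : ∀ g : Q ⟶ I.cycles a, g ≫ I.iCycles a = 0 → g = 0

/-- `nℤ`-totally acyclic complexes of finitely generated projective modules. -/
structure IsNZTotallyAcyclicProj (n : ℕ) (C : ObjectProperty (ModuleCat.{u} S))
    (P : CochainComplex (ModuleCat.{u} S) ℤ) : Prop where
  acyclic : P.Acyclic
  fgProj : ∀ j, FGProj (P.X j)
  hom_exact : ∀ Q : ModuleCat.{u} S, FGProj Q → ∀ i : ℤ,
    SegmentHomToExact P (i * n) ((i + 1) * n) Q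
  cycles_mem : ∀ i : ℤ, C (P.cycles (i * n))

/-- `nℤ`-totally acyclic complexes of finitely generated injective modules. -/
structure IsNZTotallyAcyclicInj (n : ℕ) (C : ObjectProperty (ModuleCat.{u} S))
    (I : CochainComplex (ModuleCat.{u} S) ℤ) : Prop where
  acyclic : I.Acyclic
  fgInj : ∀ j, FGInj (I.X j)
  hom_exact : ∀ Q : ModuleCat.{u} S, FGInj Q → ∀ i : ℤ,
    SegmentHomFromExact I (i * n) ((i + 1) * n) Q
  cycles_mem : ∀ i : ℤ, C (I.cycles (i * n))

/-- `nℤ-Gprj C`: the `nℤ`-Gorenstein projective modules in `C`. -/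
def NZGprj (n : ℕ) (C : ObjectProperty (ModuleCat.{u} S)) : ObjectProperty (ModuleCat.{u} S) :=
  fun G => C G ∧ ∃ P : CochainComplex (ModuleCat.{u} S) ℤ, IsNZTotallyAcyclicProj n C P ∧
    ∃ i : ℤ, Nonempty (G ≅ P.cycles (i * n))

/-- `nℤ-Ginj C`: the `nℤ`-Gorenstein injective modules in `C`. -/
def NZGinj (n : ℕ) (C : ObjectProperty (ModuleCat.{u} S)) : ObjectProperty (ModuleCat.{u} S) :=
  fun G => C G ∧ ∃ I : CochainComplex (ModuleCat.{u} S) ℤ, IsNZTotallyAcyclicInj n C I ∧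
    ∃ i : ℤ, Nonempty (G ≅ I.cycles (i * n))

/-! ### Syzygies, cosyzygies and `nℤ`-Gorenstein cluster tilting subcategories -/

/-- `K` is a `k`-th syzygy of `M`: there is an exact sequence
`0 ⟶ K ⟶ P_{k-1} ⟶ ⋯ ⟶ P_0 ⟶ M ⟶ 0` with all `P_i` finitely generated projective. -/
def IsSyzygy : ℕ → ModuleCat.{u} S → ModuleCat.{u} S → Prop
  | 0, M, K => Nonempty (K ≅ M)
  | k + 1, M, K => ∃ T : ShortComplex (ModuleCat.{u} S),
      T.ShortExact ∧ FGProj T.X₂ ∧ Nonempty (T.X₃ ≅ M) ∧ IsSyzygy k T.X₁ K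

/-- `K` is a `k`-th cosyzygy of `M`: there is an exact sequence
`0 ⟶ M ⟶ I^0 ⟶ ⋯ ⟶ I^{k-1} ⟶ K ⟶ 0` with all `I^i` finitely generated injective. -/
def IsCosyzygy : ℕ → ModuleCat.{u} S → ModuleCat.{u} S → Prop
  | 0, M, K => Nonempty (K ≅ M)
  | k + 1, M, K => ∃ T : ShortComplex (ModuleCat.{u} S),
      T.ShortExact ∧ FGInj T.X₂ ∧ Nonempty (T.X₁ ≅ M) ∧ IsCosyzygy k T.X₃ K

/-- `nℤ`-Gorenstein projective cluster tilting: for every `X` in `C` there is `i ≥ 0` with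
`Ω^{in} X` in `nℤ-Gprj C`. As the syzygy is only determined up to projective summands, this is
read as: such a syzygy exists, and every choice of it lies in `nℤ-Gprj C`. -/
structure IsNZGprjClusterTilting (n : ℕ) (C : ObjectProperty (ModuleCat.{u} S)) : Prop
    extends IsNZClusterTilting n C where
  exists_syzygy : ∀ X, C X → ∃ i : ℕ,
    (∃ K, IsSyzygy (i * n) X K) ∧ ∀ K, IsSyzygy (i * n) X K → NZGprj n C K

/-- `nℤ`-Gorenstein injective cluster tilting: for every `X` in `C` there is `i ≥ 0` with
`Ω^{-in} X` in `nℤ-Ginj C`. As the cosyzygy is only determined up to injective summands, this is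
read as: such a cosyzygy exists, and every choice of it lies in `nℤ-Ginj C`. -/
structure IsNZGinjClusterTilting (n : ℕ) (C : ObjectProperty (ModuleCat.{u} S)) : Prop
    extends IsNZClusterTilting n C where
  exists_cosyzygy : ∀ X, C X → ∃ i : ℕ,
    (∃ K, IsCosyzygy (i * n) X K) ∧ ∀ K, IsCosyzygy (i * n) X K → NZGinj n C K

/-- `nℤ`-Gorenstein cluster tilting subcategories. -/
def IsNZGClusterTilting (n : ℕ) (C : ObjectProperty (ModuleCat.{u} S)) : Prop :=
  IsNZGprjClusterTilting n C ∧ IsNZGinjClusterTilting n C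

/-- `Λ` has finite injective dimension both as a right and as a left module over itself. -/
def IsIwanagaGorenstein (Λ : Type u) [Ring Λ] : Prop :=
  (∃ d : ℕ, HasInjectiveDimensionLE (ModuleCat.of Λᵐᵒᵖ Λ) d) ∧
    (∃ d : ℕ, HasInjectiveDimensionLE (ModuleCat.of Λ Λ) d)

end NZGorenstein

/-! The core is that a finitely generated `K` with `Ext^{>0}(K, Q) = 0` for all projective `Q` is
Gorenstein projective (`ProjOrthogonal.gprj`). Embed `K` in an injective `I`. As `I` has finite
projective dimension, `K ⟶ I` lifts along an epimorphism `P ⟶ I` with `P` projective, so `K` embeds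
in a projective. Its left projective approximation is therefore mono, with orthogonal cokernel.
Continuing this way on one side and by syzygies on the other gives short exact sequences indexed by
`ℤ`, which splice to a totally acyclic complex.

Projectives have injective dimension at most some `d`, so `Ω^k X` is orthogonal for `k ≥ d`. For `X`
in `C`, dimension shifting keeps `Ω^{dn} X` in `C`. Hence `i = d` works.

For the equalities, exactness of `Hom(-, Q)` on the segments of length `n` is the same as total
acyclicity. What remains is that `Z^0 ∈ C` forces `Z^{in} ∈ C` for all `i`
(`IsNZClusterTilting.mem_of_projLink`).

The bound on projective dimensions of injective right modules comes from the left self-injective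
dimension of `Λ` through the duality `Hom_R(-, J)`, so a dualizing module `J` is constructed.
`GorensteinLike` collects what the homological argument needs; the injective half reverses the
arrows. -/

namespace NZGorenstein

/-! ### Matlis duality over a commutative artinian ring. -/

section Matlis

variable {R : Type u} [CommRing R]

/-- Injectivity of `J` is not assumed: with `M = R` the bound is what shows that the candidate
dualizing module has finite length, before it is known to be injective. -/
lemma length_linearMap_le [IsArtinianRing R] (J : Type u) [AddCommGroup J] [Module R J]
    (hJ : ∀ m : Ideal R, m.IsMaximal → Module.length R ((R ⧸ m) →ₗ[R] J) ≤ 1)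
    (M : Type u) [AddCommGroup M] [Module R M] [hM : Module.Finite R M] :
    Module.length R (M →ₗ[R] J) ≤ Module.length R M := by
  induction hM using IsNoetherianRing.induction_on_isQuotientEquivQuotientPrime R with
  | subsingleton N => simp
  | quotient N p f =>
    have hp : p.1.IsMaximal := inferInstance
    have : IsSimpleModule R (R ⧸ p.1) := isSimpleModule_iff_isCoatom.2 hp.out
    rw [f.length_eq, (LinearEquiv.congrLeft J R f).length_eq, Module.length_eq_one R (R ⧸ p.1)]
    exact hJ _ inferInstance
  | exact N₁ N₂ N₃ f g hf hg hfg h₁ h₃ =>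
    rw [Module.length_eq_add_of_exact f g hf hg hfg]
    let F : (N₃ →ₗ[R] J) →ₗ[R] (N₂ →ₗ[R] J) := g.lcomp R J
    let G : (N₂ →ₗ[R] J) →ₗ[R] (N₁ →ₗ[R] J) := f.lcomp R J
    have hF : Function.Injective F := LinearMap.lcomp_injective_of_surjective g hg
    have hFG : Function.Exact F G.rangeRestrict := by
      have := LinearMap.exact_lcomp_of_exact_of_surjective J hfg hg
      rw [LinearMap.exact_iff] at this ⊢
      rw [LinearMap.ker_rangeRestrict, this]
    rw [Module.length_eq_add_of_exact F G.rangeRestrict hF G.surjective_rangeRestrict hFG, add_comm]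
    gcongr
    exact (Module.length_le_of_injective _ (Submodule.subtype_injective _)).trans h₁

lemma length_linearMap_eq [IsArtinianRing R] (J : Type u) [AddCommGroup J] [Module R J]
    [Module.Injective R J]
    (hJ : ∀ m : Ideal R, m.IsMaximal → Module.length R ((R ⧸ m) →ₗ[R] J) = 1)
    (M : Type u) [AddCommGroup M] [Module R M] [hM : Module.Finite R M] :
    Module.length R (M →ₗ[R] J) = Module.length R M := by
  induction hM using IsNoetherianRing.induction_on_isQuotientEquivQuotientPrime R with
  | subsingleton N => simp
  | quotient N p f =>
    have hp : p.1.IsMaximal := inferInstance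
    have : IsSimpleModule R (R ⧸ p.1) := isSimpleModule_iff_isCoatom.2 hp.out
    rw [f.length_eq, (LinearEquiv.congrLeft J R f).length_eq, Module.length_eq_one R (R ⧸ p.1)]
    exact hJ _ inferInstance
  | exact N₁ N₂ N₃ f g hf hg hfg h₁ h₃ =>
    have hG : Function.Surjective (f.lcomp R J) := fun φ =>
      Module.Injective.extension_property R J _ _ f hf φ
    rw [Module.length_eq_add_of_exact f g hf hg hfg, ← h₁, ← h₃,
      Module.length_eq_add_of_exact (g.lcomp R J) (f.lcomp R J)
        (LinearMap.lcomp_injective_of_surjective g hg) hG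
        (LinearMap.exact_lcomp_of_exact_of_surjective J hfg hg), add_comm]

/-- If `x` is killed by `m` and has a nonzero multiple in the image of `∏ R ⧸ m'`, then `x` comes
from the factor `R ⧸ m`. -/
lemma exists_single_of_smul_eq {J : Type u} [AddCommGroup J] [Module R J]
    [DecidableEq (MaximalSpectrum R)]
    (φ : (∀ m : MaximalSpectrum R, R ⧸ m.1) →ₗ[R] J) (hφ : Function.Injective φ)
    (m : MaximalSpectrum R) (x : J) (hx : ∀ a ∈ m.1, a • x = 0)
    (h : ∃ (r : R) (t : ∀ m : MaximalSpectrum R, R ⧸ m.1), r • x = φ t ∧ t ≠ 0) :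
    ∃ c : R ⧸ m.1, x = φ (Pi.single m c) := by
  obtain ⟨r, t, hrt, ht⟩ := h
  have hr : r ∉ m.1 := fun hr => ht (hφ (by rw [← hrt, hx r hr, map_zero]))
  obtain ⟨s, a, ha, hs⟩ := m.2.exists_inv hr
  have hx' : x = φ (s • t) := by
    rw [map_smul, ← hrt, smul_smul]
    conv_lhs => rw [← one_smul R x, ← hs, add_smul, hx a ha, add_zero]
  refine ⟨(s • t) m, hx'.trans (congrArg φ ?_)⟩
  set t' := s • t
  funext m'
  by_cases hm : m' = m
  · subst hm; simp
  · rw [Pi.single_eq_of_ne hm]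
    have hmm : m.1 ⊔ m'.1 = ⊤ := m.2.coprime_of_ne m'.2 fun h => hm (MaximalSpectrum.ext h.symm)
    obtain ⟨a, ha, b, hb, hab⟩ := Submodule.mem_sup.1 (hmm ▸ Submodule.mem_top (x := (1 : R)))
    have h1 : a • t' = 0 := hφ (by rw [map_smul, ← hx', hx a ha, map_zero])
    have h2 : b • t' m' = 0 := by
      obtain ⟨y, hy⟩ := Ideal.Quotient.mk_surjective (t' m')
      rw [← hy, Algebra.smul_def, Ideal.Quotient.algebraMap_eq, ← map_mul,
        Ideal.Quotient.eq_zero_iff_mem]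
      exact m'.1.mul_mem_right _ hb
    rw [← one_smul R (t' m'), ← hab, add_smul, h2, add_zero, ← Pi.smul_apply, h1, Pi.zero_apply]

/-- By essentiality, every element of `J` killed by `m` lies in the one copy of `R ⧸ m` inside the
image of `φ`, so `Hom(R ⧸ m, J)` is a quotient of `R ⧸ m`; it is nonzero because it contains `j`. -/
lemma length_linearMap_quotient_eq_one {J : Type u} [AddCommGroup J] [Module R J]
    (φ : (∀ m : MaximalSpectrum R, R ⧸ m.1) →ₗ[R] J) (hφ : Function.Injective φ)
    (hess : ∀ x : J, x ≠ 0 →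
      ∃ (r : R) (t : ∀ m : MaximalSpectrum R, R ⧸ m.1), r • x = φ t ∧ t ≠ 0)
    (m : Ideal R) (hm : m.IsMaximal) : Module.length R ((R ⧸ m) →ₗ[R] J) = 1 := by
  classical
  let m' : MaximalSpectrum R := ⟨m, hm⟩
  have : IsSimpleModule R (R ⧸ m) := isSimpleModule_iff_isCoatom.2 hm.out
  let j : (R ⧸ m) →ₗ[R] J := φ ∘ₗ LinearMap.single R (fun m : MaximalSpectrum R => R ⧸ m.1) m'
  have hj : Function.Injective j := hφ.comp
    (Pi.single_injective (M := fun m : MaximalSpectrum R => R ⧸ m.1) m')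
  let F : (R ⧸ m) →ₗ[R] ((R ⧸ m) →ₗ[R] J) := (LinearMap.mul R (R ⧸ m)).compr₂ j
  have hF : Function.Surjective F := by
    intro ψ
    have key : ∃ c : R ⧸ m, ψ 1 = j c := by
      by_cases h0 : ψ 1 = 0
      · exact ⟨0, by rw [h0, map_zero]⟩
      · refine exists_single_of_smul_eq φ hφ m' (ψ 1) (fun a ha => ?_) (hess _ h0)
        rw [← map_smul, Algebra.smul_def, mul_one, Ideal.Quotient.algebraMap_eq,
          Ideal.Quotient.eq_zero_iff_mem.2 ha, map_zero]
    obtain ⟨c, hc⟩ := key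
    refine ⟨c, LinearMap.ext fun y => ?_⟩
    obtain ⟨y, rfl⟩ := Ideal.Quotient.mk_surjective y
    have h1 : (Ideal.Quotient.mk m y) = y • (1 : R ⧸ m) := by
      rw [Algebra.smul_def, mul_one]; rfl
    rw [h1, map_smul, map_smul, hc]
    simp [F]
  refine le_antisymm ((Module.length_le_of_surjective F hF).trans
    (Module.length_eq_one R (R ⧸ m)).le) (Order.one_le_iff_pos.2 (Module.length_pos_iff.2 ?_))
  have : Nontrivial (R ⧸ m) := Ideal.Quotient.nontrivial_iff.2 hm.ne_top
  refine ⟨j, 0, fun h => one_ne_zero (α := R ⧸ m) (hj ?_)⟩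
  rw [h]; simp

/-- A module of finite length which is an essential quotient of an injective module `E` over a
submodule `T` of `E` is injective. -/
lemma injective_quotient_of_essential {E T : Type u} [AddCommGroup E] [Module R E]
    [Module.Injective R E] [AddCommGroup T] [Module R T] (ι : T →ₗ[R] E) (N : Submodule R E)
    [IsArtinian R (E ⧸ N)]
    (hinj : Function.Injective (N.mkQ ∘ₗ ι))
    (hess : ∀ x : E ⧸ N, x ≠ 0 → ∃ (r : R) (t : T), r • x = (N.mkQ ∘ₗ ι) t ∧ t ≠ 0) :
    Module.Injective R (E ⧸ N) := by
  -- The endomorphism `N.mkQ ∘ₗ g` of `E ⧸ N` fixes `T`, so it is injective by essentiality and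
  -- bijective by the artinian condition. Thus `E ⧸ N` is a retract of `E`.
  obtain ⟨g, hg⟩ := Module.Injective.extension_property R E _ _ (N.mkQ ∘ₗ ι) hinj ι
  have hinj' : Function.Injective (N.mkQ ∘ₗ g) := by
    rw [← LinearMap.ker_eq_bot, LinearMap.ker_eq_bot']
    intro x hx
    by_contra hx0
    obtain ⟨r, t, hrt, ht⟩ := hess x hx0
    refine ht (hinj ?_)
    have h1 : (N.mkQ ∘ₗ g) ((N.mkQ ∘ₗ ι) t) = (N.mkQ ∘ₗ ι) t := by
      conv_rhs => rw [← hg]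
      rfl
    rw [← h1, ← hrt, map_smul, hx, smul_zero, map_zero]
  let e := LinearEquiv.ofBijective (N.mkQ ∘ₗ g)
    ⟨hinj', IsArtinian.surjective_of_injective_endomorphism _ hinj'⟩
  refine ⟨fun X Y _ _ _ _ f hf h => ?_⟩
  obtain ⟨k, hk⟩ := Module.Injective.extension_property R E _ _ f hf (g ∘ₗ e.symm.toLinearMap ∘ₗ h)
  refine ⟨N.mkQ ∘ₗ k, fun x => ?_⟩
  have := LinearMap.congr_fun hk x
  simp only [LinearMap.comp_apply] at this ⊢
  rw [this]
  exact e.apply_symm_apply (h x)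

variable (R) [IsArtinianRing R] in
/-- Existence of a Matlis dualizing module over a commutative artinian ring. -/
theorem exists_dualizing : ∃ (J : Type u) (_ : AddCommGroup J) (_ : Module R J),
    Module.Injective R J ∧ Module.Finite R J ∧
    ∀ (M : Type u) [AddCommGroup M] [Module R M] [Module.Finite R M],
      Module.length R (M →ₗ[R] J) = Module.length R M := by
  let T : Type u := ∀ m : MaximalSpectrum R, R ⧸ m.1
  let E := Injective.under (ModuleCat.of R T)
  have : Module.Injective R E :=
    Module.injective_module_of_injective_object R E
      (inj := (inferInstance : CategoryTheory.Injective E))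
  let ι : T →ₗ[R] E := (Injective.ι (ModuleCat.of R T)).hom
  have hι : Function.Injective ι := (ModuleCat.mono_iff_injective _).1 inferInstance
  -- For `N` maximal among the submodules meeting `T` trivially, `T` is essential in `E ⧸ N`, which
  -- then serves as an injective hull of `T`.
  obtain ⟨N, -, hN⟩ := zorn_le_nonempty₀ {N : Submodule R E | Disjoint N (LinearMap.range ι)}
    (fun c hc hchain y hy => ⟨sSup c, by
      refine (DirectedOn.disjoint_sSup_left hchain.directedOn).2 fun N hN => hc hN,
      fun z hz => le_sSup hz⟩) ⊥ disjoint_bot_left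
  have hinj : Function.Injective (N.mkQ ∘ₗ ι) := by
    rw [← LinearMap.ker_eq_bot, LinearMap.ker_eq_bot']
    intro t ht
    have h1 : ι t ∈ N := by simpa using ht
    exact hι (by rw [Submodule.disjoint_def.1 hN.prop _ h1 ⟨t, rfl⟩, map_zero])
  have hess : ∀ x : E ⧸ N, x ≠ 0 → ∃ (r : R) (t : T), r • x = (N.mkQ ∘ₗ ι) t ∧ t ≠ 0 := by
    intro x hx
    obtain ⟨y, rfl⟩ := N.mkQ_surjective x
    have hlt : N < N ⊔ Submodule.span R {y} := by
      refine lt_of_le_of_ne le_sup_left fun h => hx ?_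
      have : y ∈ N := by
        rw [h]; exact Submodule.mem_sup_right (Submodule.mem_span_singleton_self y)
      simpa using this
    have hnd : ¬ Disjoint (N ⊔ Submodule.span R {y}) (LinearMap.range ι) :=
      fun h => hN.not_prop_of_gt hlt h
    rw [Submodule.disjoint_def] at hnd
    push Not at hnd
    obtain ⟨z, hz, ⟨t, rfl⟩, hz0⟩ := hnd
    obtain ⟨a, ha, b, hb, hab⟩ := Submodule.mem_sup.1 hz
    obtain ⟨r, rfl⟩ := Submodule.mem_span_singleton.1 hb
    refine ⟨r, t, ?_, fun h => hz0 (by rw [h, map_zero])⟩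
    have : N.mkQ a = 0 := by simpa using ha
    rw [LinearMap.comp_apply, ← hab, map_add, this, zero_add, map_smul]
  have hlen := length_linearMap_quotient_eq_one (N.mkQ ∘ₗ ι) hinj hess
  -- `E ⧸ N` is `Hom(R, E ⧸ N)`, so its length is at most that of `R`.
  have hJlen : Module.length R (E ⧸ N) ≠ ⊤ := by
    rw [← (LinearMap.ringLmapEquivSelf R R (E ⧸ N)).length_eq]
    exact ne_top_of_le_ne_top Module.length_ne_top
      (length_linearMap_le (E ⧸ N) (fun m hm => (hlen m hm).le) R)
  obtain ⟨hnoe, hart⟩ :=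
    isFiniteLength_iff_isNoetherian_isArtinian.1 (Module.length_ne_top_iff.1 hJlen)
  have := injective_quotient_of_essential ι N hinj hess
  exact ⟨E ⧸ N, inferInstance, inferInstance, this, inferInstance,
    fun M _ _ _ => length_linearMap_eq _ hlen M⟩

variable (J : Type u) [AddCommGroup J] [Module R J] [Module.Injective R J]

/-- `J` is a cogenerator: `Hom(Rx, J)` has the positive length of `Rx`, and a nonzero map on `Rx`
extends to `M` by injectivity. -/
lemma exists_linearMap_ne_zero
    (hJ : ∀ (M : Type u) [AddCommGroup M] [Module R M] [Module.Finite R M],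
      Module.length R (M →ₗ[R] J) = Module.length R M)
    (M : Type u) [AddCommGroup M] [Module R M] (x : M) (hx : x ≠ 0) :
    ∃ f : M →ₗ[R] J, f x ≠ 0 := by
  let X := Submodule.span R {x}
  let x' : X := ⟨x, Submodule.mem_span_singleton_self x⟩
  have : Nontrivial X := ⟨x', 0, fun h => hx (congrArg Subtype.val h)⟩
  have : Nontrivial (X →ₗ[R] J) := by
    rw [← Module.length_pos_iff (R := R), hJ X]
    exact Module.length_pos
  obtain ⟨φ, hφ⟩ := exists_ne (0 : X →ₗ[R] J)
  obtain ⟨f, hf⟩ := Module.Injective.extension_property R J _ _ X.subtype X.subtype_injective φ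
  refine ⟨f, fun h => hφ (LinearMap.ext fun y => ?_)⟩
  obtain ⟨r, hr⟩ := Submodule.mem_span_singleton.1 y.2
  have h1 : φ y = f y.1 := (LinearMap.congr_fun hf y).symm
  rw [h1, ← hr, map_smul, h, smul_zero, LinearMap.zero_apply]

/-- Matlis duality: finitely generated modules are reflexive. -/
lemma exists_eval_eq [IsArtinianRing R]
    (hJ : ∀ (M : Type u) [AddCommGroup M] [Module R M] [Module.Finite R M],
      Module.length R (M →ₗ[R] J) = Module.length R M)
    [Module.Finite R J] (M : Type u) [AddCommGroup M] [Module R M]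
    [Module.Finite R M] (ψ : (M →ₗ[R] J) →ₗ[R] J) : ∃ x : M, ∀ f, ψ f = f x := by
  let ev : M →ₗ[R] ((M →ₗ[R] J) →ₗ[R] J) := LinearMap.flip LinearMap.id
  have hev : Function.Injective ev := by
    rw [← LinearMap.ker_eq_bot, LinearMap.ker_eq_bot']
    intro x hx
    by_contra h0
    obtain ⟨f, hf⟩ := exists_linearMap_ne_zero J hJ M x h0
    exact hf (LinearMap.congr_fun hx f)
  have : IsNoetherian R (M →ₗ[R] J) := isNoetherian_linearMap R J M
  have : IsNoetherian R ((M →ₗ[R] J) →ₗ[R] J) := isNoetherian_linearMap R J _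
  have : IsArtinian R ((M →ₗ[R] J) →ₗ[R] J) := inferInstance
  -- `M` and its double dual have the same finite length, so the injective evaluation map is onto.
  have hsurj : LinearMap.range ev = ⊤ := by
    by_contra h
    have h1 := Submodule.length_lt h
    rw [hJ (M →ₗ[R] J), hJ M, ← (LinearEquiv.ofInjective ev hev).length_eq] at h1
    exact lt_irrefl _ h1
  obtain ⟨x, hx⟩ := LinearMap.range_eq_top.1 hsurj ψ
  exact ⟨x, fun f => by rw [← hx]; rfl⟩

end Matlis
-- Coinduced modules as injective cogenerators.
section Coinduced

variable (R : Type u) [CommRing R] (S : Type u) [Ring S] [Algebra R S]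
  (J : Type u) [AddCommGroup J] [Module R J]

/-- The coinduced `S`-module `Hom_R(S, J)`, with action `(s • f) t = f (t * s)`. -/
def Coind : Type u := S →ₗ[R] J

namespace Coind

instance : AddCommGroup (Coind R S J) := inferInstanceAs (AddCommGroup (S →ₗ[R] J))
instance : Module R (Coind R S J) := inferInstanceAs (Module R (S →ₗ[R] J))
instance : FunLike (Coind R S J) S J := inferInstanceAs (FunLike (S →ₗ[R] J) S J)
instance : LinearMapClass (Coind R S J) R S J :=
  inferInstanceAs (LinearMapClass (S →ₗ[R] J) R S J)

variable {R S J}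

/-- The element of `Coind R S J` given by a linear map. -/
def mk (f : S →ₗ[R] J) : Coind R S J := f

@[simp] lemma mk_apply (f : S →ₗ[R] J) (s : S) : mk f s = f s := rfl

@[ext] lemma ext {f g : Coind R S J} (h : ∀ s, f s = g s) : f = g := LinearMap.ext h

@[simp] lemma add_apply (f g : Coind R S J) (s : S) : (f + g) s = f s + g s := rfl
@[simp] lemma zero_apply (s : S) : (0 : Coind R S J) s = 0 := rfl
@[simp] lemma rsmul_apply (r : R) (f : Coind R S J) (s : S) : (r • f) s = r • f s := rfl

instance : SMul S (Coind R S J) where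
  smul s f := mk ((show S →ₗ[R] J from f) ∘ₗ LinearMap.mulRight R s)

@[simp] lemma smul_apply (s : S) (f : Coind R S J) (t : S) : (s • f) t = f (t * s) := rfl

instance : Module S (Coind R S J) where
  one_smul f := by ext; simp
  mul_smul a b f := by ext; simp [mul_assoc]
  smul_zero a := by ext; simp
  smul_add a f g := by ext; simp
  add_smul a b f := by ext; simp [mul_add]
  zero_smul f := by ext; simp

instance : IsScalarTower R S (Coind R S J) where
  smul_assoc r s f := by ext t; simp

/-- The adjunction between restriction and coinduction: `R`-linear maps `M → J` induce `S`-linear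
maps `M → Hom_R(S, J)`. -/
def lift {M : Type u} [AddCommGroup M] [Module R M] [Module S M] [IsScalarTower R S M]
    (φ : M →ₗ[R] J) : M →ₗ[S] Coind R S J where
  toFun x := mk (φ ∘ₗ (LinearMap.toSpanSingleton S M x).restrictScalars R)
  map_add' x y := by ext; simp
  map_smul' s x := by ext; simp [mul_smul]

@[simp] lemma lift_apply {M : Type u} [AddCommGroup M] [Module R M] [Module S M]
    [IsScalarTower R S M] (φ : M →ₗ[R] J) (x : M) (s : S) : lift φ x s = φ (s • x) := rfl

variable (R S J)

/-- Coinduction is right adjoint to the exact restriction functor: evaluate at `1`, extend over `R`,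
and lift back. -/
instance injective [Module.Injective R J] : Module.Injective S (Coind R S J) where
  out X Y _ _ _ _ f hf g := by
    let _ : Module R X := Module.compHom X (algebraMap R S)
    let _ : Module R Y := Module.compHom Y (algebraMap R S)
    have : IsScalarTower R S X := ⟨fun r s x => by
      rw [Algebra.smul_def, mul_smul]; rfl⟩
    have : IsScalarTower R S Y := ⟨fun r s x => by
      rw [Algebra.smul_def, mul_smul]; rfl⟩
    let ev : Coind R S J →ₗ[R] J :=
      { toFun := fun h => h 1, map_add' := fun _ _ => rfl, map_smul' := fun _ _ => rfl }
    obtain ⟨h, hh⟩ := Module.Injective.extension_property R J _ _ (f.restrictScalars R) hf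
      (ev ∘ₗ g.restrictScalars R)
    refine ⟨lift h, fun x => ?_⟩
    ext s
    have := LinearMap.congr_fun hh (s • x)
    change h (f (s • x)) = g (s • x) 1 at this
    rw [lift_apply, ← map_smul, this, map_smul, smul_apply, one_mul]

instance finite [IsArtinianRing R] [Module.Finite R J] [Module.Finite R S] :
    Module.Finite S (Coind R S J) := by
  have : IsNoetherian R (S →ₗ[R] J) := isNoetherian_linearMap R J S
  have : Module.Finite R (Coind R S J) := inferInstanceAs (Module.Finite R (S →ₗ[R] J))
  exact Module.Finite.of_restrictScalars_finite R S _

end Coind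

lemma eq_zero_of_forall_generator
    (hJ : ∀ (M : Type u) [AddCommGroup M] [Module R M] (x : M), x ≠ 0 → ∃ f : M →ₗ[R] J, f x ≠ 0)
    {M : Type u} [AddCommGroup M] [Module R M] {ι : Type*} (φ : ι → (M →ₗ[R] J))
    (hφ : Submodule.span R (Set.range φ) = ⊤) (x : M) (hx : ∀ i, φ i x = 0) : x = 0 := by
  by_contra h0
  obtain ⟨f, hf⟩ := hJ M x h0
  have hmem : f ∈ Submodule.span R (Set.range φ) := hφ ▸ Submodule.mem_top
  have hle : Submodule.span R (Set.range φ) ≤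
      LinearMap.ker (LinearMap.applyₗ (R := R) (M₂ := J) x) := by
    rw [Submodule.span_le]
    rintro _ ⟨i, rfl⟩
    simpa using hx i
  exact hf (by simpa using hle hmem)

/-- Every finitely generated module over an artin algebra embeds in a finite power of the coinduced
module of a dualizing module. -/
lemma exists_injective_to_coind [IsArtinianRing R] [Module.Finite R J] [Module.Finite R S]
    (hJ : ∀ (M : Type u) [AddCommGroup M] [Module R M] (x : M), x ≠ 0 → ∃ f : M →ₗ[R] J, f x ≠ 0)
    (M : Type u) [AddCommGroup M] [Module R M] [Module S M] [IsScalarTower R S M]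
    [Module.Finite R M] :
    ∃ (m : ℕ) (f : M →ₗ[S] (Fin m → Coind R S J)), Function.Injective f := by
  have : IsNoetherian R (M →ₗ[R] J) := isNoetherian_linearMap R J M
  obtain ⟨m, φ, hφ⟩ := Module.Finite.exists_fin (R := R) (M := M →ₗ[R] J)
  refine ⟨m, LinearMap.pi fun i => Coind.lift (φ i), ?_⟩
  rw [← LinearMap.ker_eq_bot, LinearMap.ker_eq_bot']
  exact fun x hx => eq_zero_of_forall_generator R J hJ φ hφ x fun i => by
    simpa using DFunLike.congr_fun (congrFun hx i) (1 : S)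

end Coinduced

/-! ### The duality between left and right modules. -/

section Dual

variable (R : Type u) [CommRing R] {Λ : Type u} [Ring Λ] [Algebra R Λ]
  (J : Type u) [AddCommGroup J] [Module R J]

/-- The dual `Hom_R(N, J)` of a left `Λ`-module, as a right `Λ`-module. -/
def MatlisDual (N : Type u) [AddCommGroup N] [Module R N] : Type u := N →ₗ[R] J

namespace MatlisDual

section
variable (N : Type u) [AddCommGroup N] [Module R N]
instance : AddCommGroup (MatlisDual R J N) := inferInstanceAs (AddCommGroup (N →ₗ[R] J))
instance : Module R (MatlisDual R J N) := inferInstanceAs (Module R (N →ₗ[R] J))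
instance : FunLike (MatlisDual R J N) N J := inferInstanceAs (FunLike (N →ₗ[R] J) N J)
instance : LinearMapClass (MatlisDual R J N) R N J :=
  inferInstanceAs (LinearMapClass (N →ₗ[R] J) R N J)
end

variable {R J}
variable {N : Type u} [AddCommGroup N] [Module R N]

/-- The element of `MatlisDual R J N` given by a linear map. -/
def mk (f : N →ₗ[R] J) : MatlisDual R J N := f

@[simp] lemma mk_apply (f : N →ₗ[R] J) (x : N) : mk f x = f x := rfl
@[ext] lemma ext {f g : MatlisDual R J N} (h : ∀ s, f s = g s) : f = g := LinearMap.ext h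
@[simp] lemma add_apply (f g : MatlisDual R J N) (s : N) : (f + g) s = f s + g s := rfl
@[simp] lemma zero_apply (s : N) : (0 : MatlisDual R J N) s = 0 := rfl

variable [Module Λ N] [IsScalarTower R Λ N]

instance : SMul Λᵐᵒᵖ (MatlisDual R J N) where
  smul s f := mk ((show N →ₗ[R] J from f) ∘ₗ Algebra.lsmul R R N s.unop)

@[simp] lemma smul_apply (s : Λᵐᵒᵖ) (f : MatlisDual R J N) (x : N) :
    (s • f) x = f (s.unop • x) := rfl

instance : Module Λᵐᵒᵖ (MatlisDual R J N) where
  one_smul f := by ext; simp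
  mul_smul a b f := by ext; simp [mul_smul]
  smul_zero a := by ext; simp
  smul_add a f g := by ext; simp
  add_smul a b f := by ext; simp [add_smul]
  zero_smul f := by ext; simp

/-- Functoriality of the dual. -/
def map {N' : Type u} [AddCommGroup N'] [Module R N'] [Module Λ N'] [IsScalarTower R Λ N']
    (f : N →ₗ[Λ] N') : MatlisDual R J N' →ₗ[Λᵐᵒᵖ] MatlisDual R J N where
  toFun g := mk ((show N' →ₗ[R] J from g) ∘ₗ f.restrictScalars R)
  map_add' _ _ := rfl
  map_smul' s g := by
    ext x
    change g (s.unop • f x) = g (f (s.unop • x))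
    rw [f.map_smul]

@[simp] lemma map_apply {N' : Type u} [AddCommGroup N'] [Module R N'] [Module Λ N']
    [IsScalarTower R Λ N'] (f : N →ₗ[Λ] N') (g : MatlisDual R J N') (x : N) :
    map f g x = g (f x) := rfl

/-- The dual of a finitely generated injective module is projective. -/
theorem projective [IsArtinianRing R] [Module.Finite R Λ] [Module.Injective R J]
    [Module.Finite R J]
    (hJ : ∀ (M : Type u) [AddCommGroup M] [Module R M] [Module.Finite R M],
      Module.length R (M →ₗ[R] J) = Module.length R M)
    [Module.Finite R N] [Module.Injective Λ N] :
    Module.Projective Λᵐᵒᵖ (MatlisDual R J N) := by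
  have : IsNoetherian R (N →ₗ[R] J) := isNoetherian_linearMap R J N
  obtain ⟨m, φ, hφ⟩ := Module.Finite.exists_fin (R := R) (M := N →ₗ[R] J)
  let Φ : N →ₗ[Λ] (Fin m → Coind R Λ J) := LinearMap.pi fun i => Coind.lift (φ i)
  have hΦ : Function.Injective Φ := by
    rw [← LinearMap.ker_eq_bot, LinearMap.ker_eq_bot']
    exact fun x hx => eq_zero_of_forall_generator R J (exists_linearMap_ne_zero J hJ) φ hφ x
      fun i => by simpa [Φ] using DFunLike.congr_fun (congrFun hx i) (1 : Λ)
  obtain ⟨s, hs⟩ := Module.Injective.extension_property Λ N _ _ Φ hΦ LinearMap.id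
  -- `N` is a summand of a power of `Hom_R(Λ, J)`. By reflexivity of `Λ`, a functional on one factor
  -- is evaluation at an element of `Λ`. These elements are the coordinates embedding the dual of
  -- `N` in a free module, and the generators `φ` give the retraction.
  have key : ∀ (f : MatlisDual R J N) (i : Fin m), ∃ a : Λ, ∀ h : Coind R Λ J,
      f (s (Pi.single i h)) = h a := fun f i =>
    exists_eval_eq J hJ Λ ((show N →ₗ[R] J from f) ∘ₗ s.restrictScalars R ∘ₗ
      LinearMap.single R (fun _ : Fin m => Coind R Λ J) i)
  choose a ha using key
  have hinj : ∀ x y : Λ, (∀ h : Coind R Λ J, h x = h y) → x = y := fun x y h => by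
    by_contra hxy
    obtain ⟨f, hf⟩ := exists_linearMap_ne_zero J hJ Λ (x - y) (sub_ne_zero.2 hxy)
    exact hf (by rw [map_sub, sub_eq_zero]; exact h (Coind.mk f))
  let i : MatlisDual R J N →ₗ[Λᵐᵒᵖ] (Fin m → Λᵐᵒᵖ) :=
    { toFun := fun f k => MulOpposite.op (a f k)
      map_add' := fun f g => by
        funext k
        refine congrArg MulOpposite.op (hinj _ (a f k + a g k) fun h => ?_)
        rw [map_add, ← ha, ← ha, ← ha]; rfl
      map_smul' := fun c f => by
        funext k
        refine congrArg MulOpposite.op (hinj _ (a f k * c.unop) fun h => ?_)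
        rw [← Coind.smul_apply, ← ha, ← ha]
        change f (c.unop • s _) = _
        rw [← map_smul, ← Pi.single_smul] }
  let p : (Fin m → Λᵐᵒᵖ) →ₗ[Λᵐᵒᵖ] MatlisDual R J N :=
    Fintype.linearCombination Λᵐᵒᵖ fun k => mk (φ k)
  refine Module.Projective.of_split i p (LinearMap.ext fun f => MatlisDual.ext fun x => ?_)
  have h1 : ∀ (t : Finset (Fin m)) (g : Fin m → MatlisDual R J N),
      (∑ k ∈ t, g k) x = ∑ k ∈ t, g k x := fun t g => LinearMap.sum_apply t g x
  have h2 : f x = f (s (Φ x)) := by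
    have := LinearMap.congr_fun hs x
    rw [LinearMap.comp_apply] at this
    rw [this]; rfl
  rw [LinearMap.comp_apply, Fintype.linearCombination_apply, h1, LinearMap.id_apply, h2]
  conv_rhs => rw [← Finset.univ_sum_single (Φ x), map_sum, map_sum]
  refine Finset.sum_congr rfl fun k _ => ?_
  exact (ha f k (Φ x k)).symm

end MatlisDual

end Dual
-- Homological dimensions of finite powers.
section Power

variable {S : Type u} [Ring S] (G : Type u) [AddCommGroup G] [Module S G]

/-- The split short exact sequence `0 → G → G ^ (m + 1) → G ^ m → 0`. -/
def powerShortComplex (m : ℕ) : ShortComplex (ModuleCat.{u} S) :=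
  ModuleCat.shortComplexOfCompEqZero (LinearMap.single S (fun _ : Fin (m + 1) => G) 0)
    (LinearMap.funLeft S G Fin.succ) (by ext x i; simp [LinearMap.funLeft_apply])

lemma powerShortComplex_shortExact (m : ℕ) : (powerShortComplex (S := S) G m).ShortExact := by
  refine ModuleCat.shortComplex_shortExact _ ?_ (Pi.single_injective (M := fun _ => G) 0)
    (LinearMap.funLeft_surjective_of_injective _ _ _ (Fin.succ_injective m))
  intro x
  refine ⟨fun h => ⟨x 0, ?_⟩, ?_⟩
  · funext i
    refine Fin.cases ?_ (fun j => ?_) i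
    · change (Pi.single 0 (x 0) : Fin (m + 1) → G) 0 = x 0
      simp
    · have h1 : x j.succ = 0 := congrFun h j
      change (Pi.single 0 (x 0) : Fin (m + 1) → G) j.succ = x j.succ
      rw [h1]; simp
  · rintro ⟨y, rfl⟩
    exact funext fun j => Pi.single_eq_of_ne (M := fun _ : Fin (m + 1) => G) (Fin.succ_ne_zero j) y

lemma isZero_pow_zero : Limits.IsZero (ModuleCat.of S (Fin 0 → G)) :=
  ModuleCat.isZero_of_subsingleton _

lemma hasProjectiveDimensionLT_pow (k : ℕ) [HasProjectiveDimensionLT (ModuleCat.of S G) k]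
    (m : ℕ) : HasProjectiveDimensionLT (ModuleCat.of S (Fin m → G)) k := by
  induction m with
  | zero =>
    have : HasProjectiveDimensionLT (ModuleCat.of S (Fin 0 → G)) 0 :=
      (hasProjectiveDimensionLT_zero_iff_isZero _).2 (isZero_pow_zero G)
    exact hasProjectiveDimensionLT_of_ge _ 0 k (Nat.zero_le k)
  | succ m ih =>
    exact (powerShortComplex_shortExact (S := S) G m).hasProjectiveDimensionLT_X₂ k ‹_› ih

lemma hasInjectiveDimensionLT_pow (k : ℕ) [HasInjectiveDimensionLT (ModuleCat.of S G) k]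
    (m : ℕ) : HasInjectiveDimensionLT (ModuleCat.of S (Fin m → G)) k := by
  induction m with
  | zero =>
    have : HasInjectiveDimensionLT (ModuleCat.of S (Fin 0 → G)) 0 :=
      (hasInjectiveDimensionLT_zero_iff_isZero _).2 (isZero_pow_zero G)
    exact hasInjectiveDimensionLT_of_ge _ 0 k (Nat.zero_le k)
  | succ m ih =>
    exact (powerShortComplex_shortExact (S := S) G m).hasInjectiveDimensionLT_X₂ k ‹_› ih

end Power

/-! ### Approximations by powers of a fixed module. -/

section Approximation

lemma isNoetherian_linearMap_of_tower
    (R : Type u) [CommRing R] [IsArtinianRing R] {S : Type u} [Ring S] [Algebra R S]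
    (K G : Type u) [AddCommGroup K] [AddCommGroup G] [Module R K] [Module S K] [Module R G]
    [Module S G] [IsScalarTower R S K] [IsScalarTower R S G] [Module.Finite R K]
    [Module.Finite R G] :
    IsNoetherian R (K →ₗ[S] G) := by
  have := isNoetherian_linearMap R G K
  exact isNoetherian_of_injective (LinearMap.restrictScalarsₗ R S K G R)
    (LinearMap.restrictScalars_injective R)

/-- `Hom_S(K, G)` is finitely generated over `R`, and finitely many generators are the coordinates
of the approximation. The coefficients are central scalars, so they act on `G` by `S`-linear maps.
-/
lemma exists_left_approximation
    (R : Type u) [CommRing R] [IsArtinianRing R] {S : Type u} [Ring S] [Algebra R S]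
    (K G : Type u) [AddCommGroup K] [AddCommGroup G] [Module R K] [Module S K] [Module R G]
    [Module S G] [IsScalarTower R S K] [IsScalarTower R S G] [Module.Finite R K]
    [Module.Finite R G] :
    ∃ (m : ℕ) (f : K →ₗ[S] (Fin m → G)),
    ∀ (N : ℕ) (g : K →ₗ[S] (Fin N → G)), ∃ h : (Fin m → G) →ₗ[S] (Fin N → G), h ∘ₗ f = g := by
  have := isNoetherian_linearMap_of_tower R (S := S) K G
  obtain ⟨m, φ, hφ⟩ := Module.Finite.exists_fin (R := R) (M := K →ₗ[S] G)
  refine ⟨m, LinearMap.pi φ, fun N g => ?_⟩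
  have key : ∀ k : Fin N, ∃ c : Fin m → R, ∑ i, c i • φ i = LinearMap.proj k ∘ₗ g := fun k =>
    (Submodule.mem_span_range_iff_exists_fun R).1 (hφ ▸ Submodule.mem_top)
  choose c hc using key
  refine ⟨LinearMap.pi fun k => ∑ i, c k i • LinearMap.proj i, LinearMap.ext fun x => ?_⟩
  funext k
  have := LinearMap.congr_fun (hc k) x
  simpa using this

lemma exists_right_approximation
    (R : Type u) [CommRing R] [IsArtinianRing R] {S : Type u} [Ring S] [Algebra R S]
    (K G : Type u) [AddCommGroup K] [AddCommGroup G] [Module R K] [Module S K] [Module R G]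
    [Module S G] [IsScalarTower R S K] [IsScalarTower R S G] [Module.Finite R K]
    [Module.Finite R G] :
    ∃ (m : ℕ) (f : (Fin m → G) →ₗ[S] K),
    ∀ (N : ℕ) (g : (Fin N → G) →ₗ[S] K), ∃ h : (Fin N → G) →ₗ[S] (Fin m → G), f ∘ₗ h = g := by
  have := isNoetherian_linearMap_of_tower R (S := S) G K
  obtain ⟨m, φ, hφ⟩ := Module.Finite.exists_fin (R := R) (M := G →ₗ[S] K)
  refine ⟨m, LinearMap.lsum S (fun _ => G) ℕ φ, fun N g => ?_⟩
  have key : ∀ k : Fin N, ∃ c : Fin m → R,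
      ∑ i, c i • φ i = g ∘ₗ LinearMap.single S (fun _ => G) k := fun k =>
    (Submodule.mem_span_range_iff_exists_fun R).1 (hφ ▸ Submodule.mem_top)
  choose c hc using key
  refine ⟨LinearMap.lsum S (fun _ => G) ℕ fun k => LinearMap.pi fun i =>
    c k i • LinearMap.id, LinearMap.pi_ext fun k x => ?_⟩
  have := LinearMap.congr_fun (hc k) x
  rw [LinearMap.comp_apply, LinearMap.lsum_piSingle]
  simpa [LinearMap.lsum_apply] using this

end Approximation

/-! ### Injective dimension and projective dimension under duality. -/

section ArtinAlgebra

variable (R : Type u) [CommRing R] [IsArtinianRing R]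
  (J : Type u) [AddCommGroup J] [Module R J] [Module.Injective R J] [Module.Finite R J]

section
variable {Λ : Type u} [Ring Λ] [Algebra R Λ] [Module.Finite R Λ]

/-- Duality turns injective dimension into projective dimension. -/
lemma hasProjectiveDimensionLT_matlisDual
    (hJ : ∀ (M : Type u) [AddCommGroup M] [Module R M] [Module.Finite R M],
      Module.length R (M →ₗ[R] J) = Module.length R M) (d : ℕ)
    (N : Type u) [AddCommGroup N] [Module R N] [Module Λ N] [IsScalarTower R Λ N]
    [Module.Finite R N] [hN : HasInjectiveDimensionLT (ModuleCat.of Λ N) (d + 1)] :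
    HasProjectiveDimensionLT (ModuleCat.of Λᵐᵒᵖ (MatlisDual R J N)) (d + 1) := by
  induction d generalizing N with
  | zero =>
    have : Injective (ModuleCat.of Λ N) := injective_iff_hasInjectiveDimensionLT_one.2 hN
    have : Module.Injective Λ N := Module.injective_module_of_injective_object Λ N
    have := MatlisDual.projective (Λ := Λ) (N := N) hJ
    have : Projective (ModuleCat.of Λᵐᵒᵖ (MatlisDual R J N)) :=
      (IsProjective.iff_projective _).1 this
    exact projective_iff_hasProjectiveDimensionLT_one.1 this
  | succ d ih =>
    -- The cokernel of an embedding in an injective has injective dimension one less. Dualizing the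
    -- sequence puts the dual of the cokernel as a syzygy of the dual of `N`.
    obtain ⟨m, f, hf⟩ := exists_injective_to_coind R Λ J (exists_linearMap_ne_zero J hJ) N
    have hI : IsNoetherian R (Λ →ₗ[R] J) := isNoetherian_linearMap R J Λ
    have : Module.Finite R (Coind R Λ J) := inferInstanceAs (Module.Finite R (Λ →ₗ[R] J))
    let I := Fin m → Coind R Λ J
    let N' := I ⧸ LinearMap.range f
    have : Module.Finite R N' :=
      Module.Finite.of_surjective ((LinearMap.range f).mkQ.restrictScalars R)
        (LinearMap.range f).mkQ_surjective
    let T : ShortComplex (ModuleCat.{u} Λ) := ModuleCat.shortComplexOfCompEqZero f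
      (LinearMap.range f).mkQ (f.exact_map_mkQ_range.linearMap_comp_eq_zero)
    have hT : T.ShortExact := ModuleCat.shortComplex_shortExact T f.exact_map_mkQ_range hf
      (LinearMap.range f).mkQ_surjective
    have hT2 : Injective T.X₂ := Module.injective_object_of_injective_module Λ I
    have : HasInjectiveDimensionLT (ModuleCat.of Λ N') (d + 1) :=
      (hT.hasInjectiveDimensionLT_X₃_iff d hT2).2 hN
    have h1 := ih N'
    have h2 := MatlisDual.projective (Λ := Λ) (N := I) hJ
    let p : MatlisDual R J N' →ₗ[Λᵐᵒᵖ] MatlisDual R J I := MatlisDual.map (LinearMap.range f).mkQ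
    let q : MatlisDual R J I →ₗ[Λᵐᵒᵖ] MatlisDual R J N := MatlisDual.map f
    have hp : Function.Injective p :=
      LinearMap.lcomp_injective_of_surjective (R := R) (S := R) (N := J)
      ((LinearMap.range f).mkQ.restrictScalars R) (LinearMap.range f).mkQ_surjective
    have hq : Function.Surjective q := fun φ =>
      Module.Injective.extension_property R J _ _ (f.restrictScalars R) hf φ
    have hpq : Function.Exact p q := LinearMap.exact_lcomp_of_exact_of_surjective (R := R) J
      (f := f.restrictScalars R) (g := (LinearMap.range f).mkQ.restrictScalars R)
      f.exact_map_mkQ_range (LinearMap.range f).mkQ_surjective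
    let T' : ShortComplex (ModuleCat.{u} Λᵐᵒᵖ) :=
      ModuleCat.shortComplexOfCompEqZero p q hpq.linearMap_comp_eq_zero
    have hT' : T'.ShortExact := ModuleCat.shortComplex_shortExact T' hpq hp hq
    have hT'2 : Projective T'.X₂ := (IsProjective.iff_projective _).1 h2
    exact (hT'.hasProjectiveDimensionLT_X₃_iff d hT'2).2 h1

/-- The dual of `Λ` is the coinduced right module. -/
def matlisDualEquivCoind : MatlisDual R J Λ ≃ₗ[Λᵐᵒᵖ] Coind R Λᵐᵒᵖ J where
  toFun f := Coind.mk ((show Λ →ₗ[R] J from f) ∘ₗ (MulOpposite.opLinearEquiv R).symm.toLinearMap)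
  invFun f := MatlisDual.mk
    ((show Λᵐᵒᵖ →ₗ[R] J from f) ∘ₗ (MulOpposite.opLinearEquiv R).toLinearMap)
  map_add' _ _ := rfl
  map_smul' _ _ := rfl
  left_inv _ := rfl
  right_inv _ := rfl

lemma hasProjectiveDimensionLT_coind
    (hJ : ∀ (M : Type u) [AddCommGroup M] [Module R M] [Module.Finite R M],
      Module.length R (M →ₗ[R] J) = Module.length R M) (d : ℕ)
    [HasInjectiveDimensionLT (ModuleCat.of Λ Λ) (d + 1)] :
    HasProjectiveDimensionLT (ModuleCat.of Λᵐᵒᵖ (Coind R Λᵐᵒᵖ J)) (d + 1) := by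
  have := hasProjectiveDimensionLT_matlisDual R J (Λ := Λ) hJ d Λ
  exact hasProjectiveDimensionLT_of_iso (matlisDualEquivCoind R (Λ := Λ) J).toModuleIso _

end

end ArtinAlgebra

/-! ### The homological properties extracted from an Iwanaga–Gorenstein artin algebra. -/

section Bundled

variable {S : Type u} [Ring S]

lemma FGProj.exists_retract {Q : ModuleCat.{u} S} (hQ : FGProj Q) :
    ∃ m : ℕ, Nonempty (Retract Q (ModuleCat.of S (Fin m → S))) := by
  obtain ⟨_, hP⟩ := hQ
  obtain ⟨m, f, hf⟩ := Module.Finite.exists_fin' S Q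
  have hP : Module.Projective S Q := (IsProjective.iff_projective _).2 hP
  obtain ⟨g, hg⟩ := Module.projective_lifting_property f LinearMap.id hf
  exact ⟨m, ⟨⟨ModuleCat.ofHom g, ModuleCat.ofHom f, by ext x; exact LinearMap.congr_fun hg x⟩⟩⟩

lemma fgProj_pow (m : ℕ) : FGProj (ModuleCat.of S (Fin m → S)) :=
  ⟨inferInstanceAs (Module.Finite S (Fin m → S)),
    (IsProjective.iff_projective _).1 inferInstance⟩

lemma exists_fgProj_epi (M : ModuleCat.{u} S) (hM : Module.Finite S M) :
    ∃ (P : ModuleCat.{u} S) (f : P ⟶ M), FGProj P ∧ Epi f := by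
  obtain ⟨m, f, hf⟩ := Module.Finite.exists_fin' S M
  exact ⟨_, ModuleCat.ofHom f, fgProj_pow m, (ModuleCat.epi_iff_surjective _).2 hf⟩

end Bundled

/-- Noetherian rings with enough finitely generated injective modules, approximations of finitely
generated modules by projectives and injectives, and bounds for the projective (injective) dimension
of finitely generated injective (projective) modules. Iwanaga–Gorenstein artin algebras are the main
example. -/
structure GorensteinLike (S : Type u) [Ring S] : Prop where
  noetherian : IsNoetherianRing S
  exists_fgInj_mono : ∀ M : ModuleCat.{u} S, Module.Finite S M →
    ∃ (I : ModuleCat.{u} S) (f : M ⟶ I), FGInj I ∧ Mono f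
  exists_left_approx : ∀ K : ModuleCat.{u} S, Module.Finite S K →
    ∃ (P : ModuleCat.{u} S) (f : K ⟶ P), FGProj P ∧
      ∀ (Q : ModuleCat.{u} S) (g : K ⟶ Q), FGProj Q → ∃ h : P ⟶ Q, f ≫ h = g
  exists_right_approx : ∀ K : ModuleCat.{u} S, Module.Finite S K →
    ∃ (I : ModuleCat.{u} S) (f : I ⟶ K), FGInj I ∧
      ∀ (Q : ModuleCat.{u} S) (g : Q ⟶ K), FGInj Q → ∃ h : Q ⟶ I, h ≫ f = g
  exists_projDim_le : ∃ d : ℕ, ∀ Q : ModuleCat.{u} S, FGInj Q → HasProjectiveDimensionLT Q (d + 1)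
  exists_injDim_le : ∃ d : ℕ, ∀ Q : ModuleCat.{u} S, FGProj Q → HasInjectiveDimensionLT Q (d + 1)

/-- `Λ` and `Λᵐᵒᵖ` are isomorphic as right `Λ`-modules. -/
def opEquivRight (Λ : Type u) [Ring Λ] : Λ ≃ₗ[Λᵐᵒᵖ] Λᵐᵒᵖ where
  toFun := MulOpposite.op
  invFun := MulOpposite.unop
  map_add' _ _ := rfl
  map_smul' _ _ := rfl
  left_inv _ := rfl
  right_inv _ := rfl

/-- Finitely generated projectives are retracts of powers of `Λ`, so the right self-injective
dimension `d` bounds their injective dimension. Finitely generated injectives are retracts of powers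
of the dual `E` of `Λ`, whose projective dimension is bounded by the left self-injective dimension
`e`. -/
lemma gorensteinLike_of_small (R : Type u) [CommRing R] [IsArtinianRing R]
    {Λ : Type u} [Ring Λ] [Algebra R Λ] [Module.Finite R Λ] (hΛ : IsIwanagaGorenstein Λ) :
    GorensteinLike Λᵐᵒᵖ := by
  obtain ⟨⟨d, hd⟩, ⟨e, he⟩⟩ := hΛ
  obtain ⟨J, _, _, _, _, hJ⟩ := exists_dualizing R
  have : Module.Finite R Λᵐᵒᵖ := Module.Finite.equiv (MulOpposite.opLinearEquiv R)
  have hI : IsNoetherian R (Λᵐᵒᵖ →ₗ[R] J) := isNoetherian_linearMap R J Λᵐᵒᵖ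
  have : Module.Finite R (Coind R Λᵐᵒᵖ J) := inferInstanceAs (Module.Finite R (Λᵐᵒᵖ →ₗ[R] J))
  let E := Coind R Λᵐᵒᵖ J
  have fgE : ∀ m : ℕ, FGInj (ModuleCat.of Λᵐᵒᵖ (Fin m → E)) := fun m =>
    ⟨inferInstanceAs (Module.Finite Λᵐᵒᵖ (Fin m → E)),
      Module.injective_object_of_injective_module Λᵐᵒᵖ (Fin m → E)⟩
  have emb : ∀ M : ModuleCat.{u} Λᵐᵒᵖ, Module.Finite Λᵐᵒᵖ M →
      ∃ (m : ℕ) (f : M ⟶ ModuleCat.of Λᵐᵒᵖ (Fin m → E)), Mono f := fun M hM => by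
    let _ : Module R M := Module.compHom M (algebraMap R Λᵐᵒᵖ)
    have : IsScalarTower R Λᵐᵒᵖ M := ⟨fun r s x => by rw [Algebra.smul_def, mul_smul]; rfl⟩
    have : Module.Finite R M := Module.Finite.trans Λᵐᵒᵖ M
    obtain ⟨m, f, hf⟩ :=
      exists_injective_to_coind R Λᵐᵒᵖ J (exists_linearMap_ne_zero J hJ) M
    exact ⟨m, ModuleCat.ofHom f, (ModuleCat.mono_iff_injective _).2 hf⟩
  have injRetract : ∀ Q : ModuleCat.{u} Λᵐᵒᵖ, FGInj Q →
      ∃ m : ℕ, Nonempty (Retract Q (ModuleCat.of Λᵐᵒᵖ (Fin m → E))) := fun Q hQ => by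
    obtain ⟨m, f, hf⟩ := emb Q hQ.1
    have := hQ.2
    exact ⟨m, ⟨⟨f, Injective.factorThru (𝟙 Q) f, Injective.comp_factorThru _ _⟩⟩⟩
  refine ⟨?_, fun M hM => ?_, fun K hK => ?_, fun K hK => ?_, ⟨e, fun Q hQ => ?_⟩,
    ⟨d, fun Q hQ => ?_⟩⟩
  · exact IsNoetherianRing.of_finite R Λᵐᵒᵖ
  · obtain ⟨m, f, hf⟩ := emb M hM
    exact ⟨_, f, fgE m, hf⟩
  · let _ : Module R K := Module.compHom K (algebraMap R Λᵐᵒᵖ)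
    have : IsScalarTower R Λᵐᵒᵖ K := ⟨fun r s x => by rw [Algebra.smul_def, mul_smul]; rfl⟩
    have : Module.Finite R K := Module.Finite.trans Λᵐᵒᵖ K
    obtain ⟨m, f, hf⟩ := exists_left_approximation R (S := Λᵐᵒᵖ) K Λᵐᵒᵖ
    refine ⟨_, ModuleCat.ofHom f, fgProj_pow m, fun Q g hQ => ?_⟩
    obtain ⟨N, ⟨r⟩⟩ := hQ.exists_retract
    obtain ⟨h, hh⟩ := hf N (g ≫ r.i).hom
    refine ⟨ModuleCat.ofHom h ≫ r.r, ?_⟩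
    have h1 : ModuleCat.ofHom f ≫ ModuleCat.ofHom h = g ≫ r.i := ModuleCat.hom_ext hh
    rw [reassoc_of% h1, r.retract, Category.comp_id]
  · let _ : Module R K := Module.compHom K (algebraMap R Λᵐᵒᵖ)
    have : IsScalarTower R Λᵐᵒᵖ K := ⟨fun r s x => by rw [Algebra.smul_def, mul_smul]; rfl⟩
    have : Module.Finite R K := Module.Finite.trans Λᵐᵒᵖ K
    obtain ⟨m, f, hf⟩ := exists_right_approximation R (S := Λᵐᵒᵖ) K E
    refine ⟨_, ModuleCat.ofHom f, fgE m, fun Q g hQ => ?_⟩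
    obtain ⟨N, ⟨r⟩⟩ := injRetract Q hQ
    obtain ⟨h, hh⟩ := hf N (r.r ≫ g).hom
    refine ⟨r.i ≫ ModuleCat.ofHom h, ?_⟩
    have h1 : ModuleCat.ofHom h ≫ ModuleCat.ofHom f = r.r ≫ g := ModuleCat.hom_ext hh
    rw [Category.assoc, h1, r.retract_assoc]
  · obtain ⟨m, ⟨r⟩⟩ := injRetract Q hQ
    have := hasProjectiveDimensionLT_coind R (Λ := Λ) J hJ e
    have := hasProjectiveDimensionLT_pow (S := Λᵐᵒᵖ) E (e + 1) m
    exact r.hasProjectiveDimensionLT _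
  · obtain ⟨m, ⟨r⟩⟩ := hQ.exists_retract
    have : HasInjectiveDimensionLT (ModuleCat.of Λᵐᵒᵖ Λᵐᵒᵖ) (d + 1) :=
      hasInjectiveDimensionLT_of_iso (opEquivRight Λ).toModuleIso _
    have := hasInjectiveDimensionLT_pow (S := Λᵐᵒᵖ) Λᵐᵒᵖ (d + 1) m
    exact r.hasInjectiveDimensionLT _

/-- An Iwanaga–Gorenstein artin algebra satisfies `GorensteinLike`. The base ring may be replaced
by the center of the algebra, which lives in the right universe. -/
theorem gorensteinLike {R : Type*} [CommRing R] [IsArtinianRing R]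
    {Λ : Type u} [Ring Λ] [Algebra R Λ] [Module.Finite R Λ] (hΛ : IsIwanagaGorenstein Λ) :
    GorensteinLike Λᵐᵒᵖ := by
  let Z := Subring.center Λ
  let _ : Algebra R Z := ((algebraMap R Λ).codRestrict Z fun r =>
    Subring.mem_center_iff.2 fun x => (Algebra.commutes r x).symm).toAlgebra
  have : IsScalarTower R Z Λ := IsScalarTower.of_algebraMap_eq' rfl
  have : Module.Finite R Z := Module.Finite.of_injective
    (IsScalarTower.toAlgHom R Z Λ).toLinearMap Subtype.val_injective
  have : IsArtinianRing Z := IsArtinianRing.of_finite R Z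
  have : Module.Finite Z Λ := Module.Finite.of_restrictScalars_finite R Z Λ
  exact gorensteinLike_of_small Z hΛ

/-! ### Vanishing of Ext along short exact sequences. -/

section ExtVanishing

universe w v t

variable {A : Type t} [Category.{v} A] [Abelian A] [HasExt.{w} A]

open Abelian

lemma subsingleton_ext_of_iso_left {X X' Y : A} (e : X ≅ X') (i : ℕ)
    (h : Subsingleton (Ext X Y i)) : Subsingleton (Ext X' Y i) := by
  refine subsingleton_of_forall_eq 0 fun x => ?_
  rw [← x.mk₀_id_comp, ← e.inv_hom_id, ← Ext.mk₀_comp_mk₀, Ext.comp_assoc_of_second_deg_zero,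
    Subsingleton.elim ((Ext.mk₀ e.hom).comp x (zero_add i)) 0, Ext.comp_zero]

lemma subsingleton_ext_of_iso_right {X Y Y' : A} (e : Y ≅ Y') (i : ℕ)
    (h : Subsingleton (Ext X Y i)) : Subsingleton (Ext X Y' i) := by
  refine subsingleton_of_forall_eq 0 fun x => ?_
  rw [← x.comp_mk₀_id, ← e.inv_hom_id, ← Ext.mk₀_comp_mk₀, ← Ext.comp_assoc_of_second_deg_zero,
    Subsingleton.elim (x.comp (Ext.mk₀ e.inv) (add_zero i)) 0, Ext.zero_comp]

variable {T : ShortComplex A}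

lemma subsingleton_ext_X₁_left (hT : T.ShortExact) (Y : A)
    (i : ℕ) (h₂ : Subsingleton (Ext T.X₂ Y i))
    (h₃ : Subsingleton (Ext T.X₃ Y (i + 1))) : Subsingleton (Ext T.X₁ Y i) := by
  refine subsingleton_of_forall_eq 0 fun x => ?_
  obtain ⟨y, rfl⟩ := Ext.contravariant_sequence_exact₁ hT Y x (add_comm 1 i)
    (Subsingleton.elim _ _)
  rw [Subsingleton.elim y 0, Ext.comp_zero]

lemma subsingleton_ext_X₃_left (hT : T.ShortExact) (Y : A)
    (i : ℕ) (h₁ : Subsingleton (Ext T.X₁ Y i))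
    (h₂ : Subsingleton (Ext T.X₂ Y (i + 1))) : Subsingleton (Ext T.X₃ Y (i + 1)) := by
  refine subsingleton_of_forall_eq 0 fun x => ?_
  obtain ⟨y, rfl⟩ := Ext.contravariant_sequence_exact₃ hT Y x (Subsingleton.elim _ _)
    (add_comm 1 i)
  rw [Subsingleton.elim y 0, Ext.comp_zero]

lemma subsingleton_ext_X₃_right (hT : T.ShortExact) (Y : A)
    (i : ℕ) (h₂ : Subsingleton (Ext Y T.X₂ i))
    (h₁ : Subsingleton (Ext Y T.X₁ (i + 1))) : Subsingleton (Ext Y T.X₃ i) := by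
  refine subsingleton_of_forall_eq 0 fun x => ?_
  obtain ⟨y, rfl⟩ := Ext.covariant_sequence_exact₃ Y hT x rfl (Subsingleton.elim _ _)
  rw [Subsingleton.elim y 0, Ext.zero_comp]

lemma subsingleton_ext_X₁_right (hT : T.ShortExact) (Y : A)
    (i : ℕ) (h₃ : Subsingleton (Ext Y T.X₃ i))
    (h₂ : Subsingleton (Ext Y T.X₂ (i + 1))) : Subsingleton (Ext Y T.X₁ (i + 1)) := by
  refine subsingleton_of_forall_eq 0 fun x => ?_
  obtain ⟨y, rfl⟩ := Ext.covariant_sequence_exact₁ Y hT x (Subsingleton.elim _ _) rfl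
  rw [Subsingleton.elim y 0, Ext.zero_comp]

lemma exists_extension (hT : T.ShortExact) (Y : A)
    (h : Subsingleton (Ext T.X₃ Y 1)) (f : T.X₁ ⟶ Y) :
    ∃ g : T.X₂ ⟶ Y, T.f ≫ g = f := by
  obtain ⟨y, hy⟩ := Ext.contravariant_sequence_exact₁ hT Y (Ext.mk₀ f) (add_zero 1)
    (Subsingleton.elim _ _)
  obtain ⟨g, rfl⟩ := (Ext.mk₀_bijective _ _).2 y
  exact ⟨g, (Ext.mk₀_bijective _ _).1 (by rw [← hy, Ext.mk₀_comp_mk₀])⟩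

lemma exists_lift (hT : T.ShortExact) (Y : A)
    (h : Subsingleton (Ext Y T.X₁ 1)) (f : Y ⟶ T.X₃) :
    ∃ g : Y ⟶ T.X₂, g ≫ T.g = f := by
  obtain ⟨y, hy⟩ := Ext.covariant_sequence_exact₃ Y hT (Ext.mk₀ f) (zero_add 1)
    (Subsingleton.elim _ _)
  obtain ⟨g, rfl⟩ := (Ext.mk₀_bijective _ _).2 y
  exact ⟨g, (Ext.mk₀_bijective _ _).1 (by rw [← hy, Ext.mk₀_comp_mk₀])⟩

/-- Each class is the extension class of `T` followed by some `f : T.X₁ ⟶ Y`, and this product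
vanishes when `f` factors through `T.f`. -/
lemma subsingleton_ext_one_of_extension (hT : T.ShortExact) (Y : A)
    (h₂ : Subsingleton (Ext T.X₂ Y 1))
    (h : ∀ f : T.X₁ ⟶ Y, ∃ g : T.X₂ ⟶ Y, T.f ≫ g = f) : Subsingleton (Ext T.X₃ Y 1) := by
  refine subsingleton_of_forall_eq 0 fun x => ?_
  obtain ⟨y, rfl⟩ := Ext.contravariant_sequence_exact₃ hT Y x (Subsingleton.elim _ _)
    (add_zero 1)
  obtain ⟨f, rfl⟩ := (Ext.mk₀_bijective _ _).2 y
  obtain ⟨g, rfl⟩ := h f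
  rw [← Ext.mk₀_comp_mk₀, hT.extClass_comp_assoc]

lemma subsingleton_ext_one_of_lift (hT : T.ShortExact) (Y : A)
    (h₂ : Subsingleton (Ext Y T.X₂ 1))
    (h : ∀ f : Y ⟶ T.X₃, ∃ g : Y ⟶ T.X₂, g ≫ T.g = f) : Subsingleton (Ext Y T.X₁ 1) := by
  refine subsingleton_of_forall_eq 0 fun x => ?_
  obtain ⟨y, rfl⟩ := Ext.covariant_sequence_exact₁ Y hT x (Subsingleton.elim _ _)
    (zero_add 1)
  obtain ⟨f, rfl⟩ := (Ext.mk₀_bijective _ _).2 y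
  obtain ⟨g, rfl⟩ := h f
  rw [← Ext.mk₀_comp_mk₀, Ext.comp_assoc_of_second_deg_zero, hT.comp_extClass, Ext.comp_zero]

end ExtVanishing

/-! ### Splicing short exact sequences into acyclic complexes, and back. -/

section Splice

universe v t

variable {A : Type t} [Category.{v} A] [Abelian A]

section
variable (Z X : ℤ → A) (i : ∀ j, Z j ⟶ X j) (p : ∀ j, X j ⟶ Z (j + 1)) (w : ∀ j, i j ≫ p j = 0)

/-- The complex obtained by splicing short exact sequences `0 → Z j → X j → Z (j + 1) → 0`. -/
def splice : CochainComplex A ℤ :=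
  CochainComplex.of X (fun j => p j ≫ i (j + 1)) fun j => by
    rw [Category.assoc, reassoc_of% (w (j + 1)), Limits.zero_comp, Limits.comp_zero]

lemma splice_d (j : ℤ) : (splice Z X i p w).d j (j + 1) = p j ≫ i (j + 1) :=
  CochainComplex.of_d X (fun j => p j ≫ i (j + 1)) j

lemma splice_acyclic
    (h : ∀ j, (ShortComplex.mk (i j) (p j) (w j)).ShortExact) : (splice Z X i p w).Acyclic := by
  intro j
  obtain ⟨k, rfl⟩ : ∃ k, j = k + 1 := ⟨j - 1, by ring⟩
  rw [HomologicalComplex.exactAt_iff' _ k (k + 1) (k + 1 + 1) (by simp) (by simp)]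
  have hepi : Epi (p k) := (h k).epi_g
  have hmono : Mono (i (k + 1 + 1)) := (h (k + 1 + 1)).mono_f
  have hw : (p k ≫ i (k + 1)) ≫ p (k + 1) = 0 := by rw [Category.assoc, w, Limits.comp_zero]
  let φ : ShortComplex.mk (p k ≫ i (k + 1)) (p (k + 1)) hw ⟶
      ShortComplex.mk (i (k + 1)) (p (k + 1)) (w (k + 1)) :=
    { τ₁ := p k, τ₂ := 𝟙 _, τ₃ := 𝟙 _ }
  have : Epi φ.τ₁ := hepi
  have h1 := (ShortComplex.exact_iff_of_epi_of_isIso_of_mono φ).2 (h (k + 1)).exact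
  let ψ : ShortComplex.mk (p k ≫ i (k + 1)) (p (k + 1)) hw ⟶
      (splice Z X i p w).sc' k (k + 1) (k + 1 + 1) :=
    { τ₁ := 𝟙 _, τ₂ := 𝟙 _, τ₃ := i (k + 1 + 1)
      comm₁₂ := (Category.id_comp _).trans
        ((splice_d Z X i p w k).trans (Category.comp_id (p k ≫ i (k + 1))).symm)
      comm₂₃ := (Category.id_comp _).trans (splice_d Z X i p w (k + 1)) }
  have : Epi ψ.τ₁ := inferInstanceAs (Epi (𝟙 (X k)))
  have : IsIso ψ.τ₂ := inferInstanceAs (IsIso (𝟙 (X (k + 1))))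
  have : Mono ψ.τ₃ := hmono
  exact (ShortComplex.exact_iff_of_epi_of_isIso_of_mono ψ).1 h1

lemma nonempty_iso_splice_cycles
    (h : ∀ j, (ShortComplex.mk (i j) (p j) (w j)).ShortExact) (j : ℤ) :
    Nonempty (Z j ≅ (splice Z X i p w).cycles j) := by
  have := (h (j + 1)).mono_f
  have hk := (h j).fIsKernel
  have hw : i j ≫ (splice Z X i p w).d j (j + 1) = 0 := by
    have h0 : i j ≫ p j ≫ i (j + 1) = 0 := by rw [reassoc_of% (w j), Limits.zero_comp]
    rw [splice_d]
    exact h0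
  have hk' : Limits.IsLimit
      (Limits.KernelFork.ofι (f := (splice Z X i p w).d j (j + 1)) (i j) hw) :=
    Limits.isKernelCompMono hk (i (j + 1)) (splice_d Z X i p w j)
  exact ⟨hk'.conePointUniqueUpToIso ((splice Z X i p w).cyclesIsKernel j (j + 1) (by simp))⟩

end

variable {P : CochainComplex A ℤ}

lemma epi_toCycles (hP : P.Acyclic) (j k : ℤ) (hjk : j + 1 = k) : Epi (P.toCycles j k) :=
  Preadditive.epi_of_isZero_cokernel' _ (P.homologyIsCokernel j k (by simp [← hjk]))
    ((P.exactAt_iff_isZero_homology k).1 (hP k))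

variable (P) in
/-- The short complex `0 → Z^j → P^j → Z^k → 0` for `k = j + 1`. -/
noncomputable def cyclesShortComplex (j k : ℤ) : ShortComplex A :=
  ShortComplex.mk (P.iCycles j) (P.toCycles j k) (by
    rw [← cancel_mono (P.iCycles k), Category.assoc, P.toCycles_i, P.iCycles_d, Limits.zero_comp])

lemma cyclesShortComplex_shortExact (hP : P.Acyclic) (j k : ℤ) (hjk : j + 1 = k) :
    (cyclesShortComplex P j k).ShortExact where
  mono_f := inferInstanceAs (Mono (P.iCycles j))
  epi_g := epi_toCycles hP j k hjk
  exact := by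
    let φ : cyclesShortComplex P j k ⟶ ShortComplex.mk _ _ (P.iCycles_d j k) :=
      { τ₁ := 𝟙 _, τ₂ := 𝟙 _, τ₃ := P.iCycles k
        comm₁₂ := by simp [cyclesShortComplex]
        comm₂₃ := by simp [cyclesShortComplex] }
    have : Mono φ.τ₃ := inferInstanceAs (Mono (P.iCycles k))
    have : Epi φ.τ₁ := inferInstanceAs (Epi (𝟙 _))
    have : IsIso φ.τ₂ := inferInstanceAs (IsIso (𝟙 _))
    exact (ShortComplex.exact_iff_of_epi_of_isIso_of_mono φ).2
      (ShortComplex.exact_of_f_is_kernel _ (P.cyclesIsKernel j k (by simp [← hjk])))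

end Splice
-- Used to continue a module to a chain of links indexed by `ℤ`, by choosing successors and
-- predecessors separately.
lemma exists_int_chain {α : Type*} (r : α → α → Prop) (fwd : ∀ a, ∃ b, r a b)
    (bwd : ∀ b, ∃ a, r a b) (a : α) : ∃ Z : ℤ → α, Z 0 = a ∧ ∀ j, r (Z j) (Z (j + 1)) := by
  choose f hf using fwd
  choose g hg using bwd
  let Z : ℤ → α
    | Int.ofNat n => f^[n] a
    | Int.negSucc n => g^[n + 1] a
  refine ⟨Z, rfl, fun j => ?_⟩
  match j with
  | Int.ofNat n =>
    change r (f^[n] a) (f^[n + 1] a)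
    rw [Function.iterate_succ_apply']
    exact hf _
  | Int.negSucc 0 => exact hg a
  | Int.negSucc (n + 1) =>
    change r (g^[n + 1 + 1] a) (g^[n + 1] a)
    rw [Function.iterate_succ_apply' g (n + 1)]
    exact hg _

variable {S : Type u} [Ring S]

/-! ### Totally acyclic complexes of projectives and their `nℤ`-version. -/

section Proj

/-- A short exact sequence `0 → A → X → B → 0` with `X` finitely generated projective which stays
exact under `Hom(-, Q)` for all finitely generated projective `Q`. -/
def ProjLink (A B : ModuleCat.{u} S) : Prop :=
  ∃ (X : ModuleCat.{u} S) (i : A ⟶ X) (p : X ⟶ B) (w : i ≫ p = 0),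
    (ShortComplex.mk i p w).ShortExact ∧ FGProj X ∧
      ∀ Q : ModuleCat.{u} S, FGProj Q → ∀ f : A ⟶ Q, ∃ g : X ⟶ Q, i ≫ g = f

lemma gprj_of_projLink (Z : ℤ → ModuleCat.{u} S) (h : ∀ j, ProjLink (Z j) (Z (j + 1))) :
    Gprj (Z 0) := by
  choose X i p w hT hX hQ using h
  refine ⟨splice Z X i p w, ⟨splice_acyclic Z X i p w hT, hX, fun Q hQ' j f hf => ?_⟩,
    nonempty_iso_splice_cycles Z X i p w hT 0⟩
  obtain ⟨k, rfl⟩ : ∃ k, j = k + 1 := ⟨j - 1, by ring⟩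
  rw [add_sub_cancel_right, splice_d] at hf
  have := (hT (k + 1)).epi_g
  have hf' : i (k + 1) ≫ f = 0 := by
    have : Epi (p k) := (hT k).epi_g
    rw [← cancel_epi (p k), Limits.comp_zero]
    exact (Category.assoc _ _ _).symm.trans hf
  obtain ⟨g, hg⟩ := hQ (k + 1 + 1) Q hQ' ((hT (k + 1)).exact.desc f hf')
  refine ⟨g, ?_⟩
  rw [splice_d]
  exact (Category.assoc _ _ _).trans ((congrArg (p (k + 1) ≫ ·) hg).trans
    ((hT (k + 1)).exact.g_desc f hf'))

/-- Composing `f` with the epimorphism onto the cycles gives a cocycle of `Hom(P, Q)`; a cochain it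
bounds is the extension. -/
lemma IsTotallyAcyclicProj.exists_extension {P : CochainComplex (ModuleCat.{u} S) ℤ}
    (hP : IsTotallyAcyclicProj P) {Q : ModuleCat.{u} S} (hQ : FGProj Q) (j : ℤ)
    (f : P.cycles j ⟶ Q) : ∃ g : P.X j ⟶ Q, P.iCycles j ≫ g = f := by
  obtain ⟨k, rfl⟩ : ∃ k, j = k + 1 := ⟨j - 1, by ring⟩
  have := epi_toCycles hP.acyclic k (k + 1) rfl
  obtain ⟨g, hg⟩ := hP.hom_exact Q hQ k (P.toCycles k (k + 1) ≫ f)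
    (by rw [P.d_toCycles_assoc, Limits.zero_comp])
  refine ⟨g, ?_⟩
  rw [← cancel_epi (P.toCycles k (k + 1)), P.toCycles_i_assoc, hg]

lemma IsTotallyAcyclicProj.projLink {P : CochainComplex (ModuleCat.{u} S) ℤ}
    (hP : IsTotallyAcyclicProj P) (j : ℤ) : ProjLink (P.cycles j) (P.cycles (j + 1)) :=
  ⟨P.X j, P.iCycles j, P.toCycles j (j + 1), _,
    cyclesShortComplex_shortExact hP.acyclic j (j + 1) rfl, hP.fgProj j,
    fun _ hQ f => hP.exists_extension hQ j f⟩

lemma exists_extension_of_acyclic {P : CochainComplex (ModuleCat.{u} S) ℤ}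
    (hP : P.Acyclic) (Q : ModuleCat.{u} S) (j k : ℤ) (hjk : j + 1 = k)
    (h : ∀ f : P.cycles k ⟶ Q, ∃ g : P.X k ⟶ Q, P.iCycles k ≫ g = f)
    (f : P.X j ⟶ Q) (hf : P.iCycles j ≫ f = 0) : ∃ g : P.X k ⟶ Q, P.d j k ≫ g = f := by
  have hT := cyclesShortComplex_shortExact hP j k hjk
  have := hT.epi_g
  obtain ⟨g, hg⟩ := h (hT.exact.desc f hf)
  refine ⟨g, ?_⟩
  rw [← P.toCycles_i, Category.assoc, hg]
  exact hT.exact.g_desc f hf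

lemma iCycles_comp_eq_zero {P : CochainComplex (ModuleCat.{u} S) ℤ}
    (hP : P.Acyclic) (Q : ModuleCat.{u} S) (j : ℤ) (f : P.X j ⟶ Q) (hf : P.d (j - 1) j ≫ f = 0) :
    P.iCycles j ≫ f = 0 := by
  have := epi_toCycles hP (j - 1) j (by ring)
  rw [← cancel_epi (P.toCycles (j - 1) j), P.toCycles_i_assoc, hf, Limits.comp_zero]

lemma segmentHomToExact_of_extension {P : CochainComplex (ModuleCat.{u} S) ℤ}
    (hP : P.Acyclic) (Q : ModuleCat.{u} S)
    (h : ∀ j, ∀ f : P.cycles j ⟶ Q, ∃ g : P.X j ⟶ Q, P.iCycles j ≫ g = f) (a b : ℤ) (hab : a < b) :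
    SegmentHomToExact P a b Q where
  exact_first := h a
  exact_mid j haj hjb f h1 h2 := by
    refine exists_extension_of_acyclic hP Q j (j + 1) rfl (h (j + 1)) f ?_
    rcases haj.eq_or_lt with h' | h'
    · exact h1 h'.symm
    · exact iCycles_comp_eq_zero hP Q j f (h2 h')
  exact_last f h1 h2 := by
    have hT := cyclesShortComplex_shortExact hP (b - 1) b (by ring)
    have := hT.epi_g
    have hf : P.iCycles (b - 1) ≫ f = 0 := by
      rcases (Int.le_sub_one_of_lt hab).eq_or_lt with h' | h'
      · exact h1 h'.symm
      · exact iCycles_comp_eq_zero hP Q _ f (h2 h')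
    exact ⟨hT.exact.desc f hf, hT.exact.g_desc f hf⟩
  exact_end g hg := by
    have := epi_toCycles hP (b - 1) b (by ring)
    rwa [← cancel_epi (P.toCycles (b - 1) b), Limits.comp_zero]

lemma IsTotallyAcyclicProj.isNZTotallyAcyclicProj {P : CochainComplex (ModuleCat.{u} S) ℤ}
    (hP : IsTotallyAcyclicProj P) {n : ℕ} (hn : 0 < n) {C : ObjectProperty (ModuleCat.{u} S)}
    (hC : ∀ i : ℤ, C (P.cycles (i * n))) : IsNZTotallyAcyclicProj n C P where
  acyclic := hP.acyclic
  fgProj := hP.fgProj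
  cycles_mem := hC
  hom_exact Q hQ i := by
    have hn' : (0 : ℤ) < n := by exact_mod_cast hn
    exact segmentHomToExact_of_extension hP.acyclic Q (fun j f => hP.exists_extension hQ j f) _ _
      (by rw [add_mul, one_mul]; exact lt_add_of_pos_right _ hn')

/-- Inside a segment this is `exact_mid`. At `j = b - 1` the segment only yields a map on `Z^b`,
which must still be extended to `P^b`; `hb` provides this and comes from the next segment. -/
lemma SegmentHomToExact.exists_extension {P : CochainComplex (ModuleCat.{u} S) ℤ}
    {Q : ModuleCat.{u} S} {a b : ℤ}
    (h : SegmentHomToExact P a b Q) (hP : P.Acyclic)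
    (hb : ∀ f : P.cycles b ⟶ Q, ∃ g : P.X b ⟶ Q, P.iCycles b ≫ g = f) (j k : ℤ) (hjk : j + 1 = k)
    (haj : a ≤ j) (hjb : j < b) (f : P.X j ⟶ Q) (hf : P.d (j - 1) j ≫ f = 0) :
    ∃ g : P.X k ⟶ Q, P.d j k ≫ g = f := by
  by_cases hj : j < b - 1
  · subst hjk
    exact h.exact_mid j haj hj f (fun _ => iCycles_comp_eq_zero hP Q j f hf) fun _ => hf
  · obtain rfl : j = b - 1 := by omega
    obtain rfl : k = b := by omega
    obtain ⟨g, hg⟩ := h.exact_last f (fun _ => iCycles_comp_eq_zero hP Q _ f hf) fun _ => hf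
    obtain ⟨g', hg'⟩ := hb g
    exact ⟨g', by rw [← P.toCycles_i, Category.assoc, hg', hg]⟩

lemma IsNZTotallyAcyclicProj.isTotallyAcyclicProj {P : CochainComplex (ModuleCat.{u} S) ℤ}
    {n : ℕ} (hn : 0 < n) {C : ObjectProperty (ModuleCat.{u} S)}
    (hP : IsNZTotallyAcyclicProj n C P) : IsTotallyAcyclicProj P where
  acyclic := hP.acyclic
  fgProj := hP.fgProj
  hom_exact Q hQ j f hf := by
    have hn' : (0 : ℤ) < n := by exact_mod_cast hn
    -- Degree `j` belongs to the segment whose index is the floor of `j / n`.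
    refine (hP.hom_exact Q hQ (j / n)).exists_extension hP.acyclic
      (hP.hom_exact Q hQ (j / n + 1)).exact_first j (j + 1) rfl
      (Int.ediv_mul_le j hn'.ne') (Int.lt_ediv_add_one_mul_self j hn') f hf

end Proj

/-! ### Totally acyclic complexes of injectives and their `nℤ`-version. -/

section Inj

/-- A short exact sequence `0 → A → X → B → 0` with `X` finitely generated injective which stays
exact under `Hom(Q, -)` for all finitely generated injective `Q`. -/
def InjLink (A B : ModuleCat.{u} S) : Prop :=
  ∃ (X : ModuleCat.{u} S) (i : A ⟶ X) (p : X ⟶ B) (w : i ≫ p = 0),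
    (ShortComplex.mk i p w).ShortExact ∧ FGInj X ∧
      ∀ Q : ModuleCat.{u} S, FGInj Q → ∀ f : Q ⟶ B, ∃ g : Q ⟶ X, g ≫ p = f

lemma ginj_of_injLink (Z : ℤ → ModuleCat.{u} S) (h : ∀ j, InjLink (Z j) (Z (j + 1))) :
    Ginj (Z 0) := by
  choose X i p w hT hX hQ using h
  refine ⟨splice Z X i p w, ⟨splice_acyclic Z X i p w hT, hX, fun Q hQ' j f hf => ?_⟩,
    nonempty_iso_splice_cycles Z X i p w hT 0⟩
  obtain ⟨k, rfl⟩ : ∃ k, j = k + 1 := ⟨j - 1, by ring⟩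
  rw [add_sub_cancel_right, splice_d]
  rw [splice_d] at hf
  have := (hT (k + 1)).mono_f
  have hf' : f ≫ p (k + 1) = 0 := by
    have : Mono (i (k + 1 + 1)) := (hT (k + 1 + 1)).mono_f
    rw [← cancel_mono (i (k + 1 + 1)), Limits.zero_comp]
    exact (Category.assoc _ _ _).trans hf
  obtain ⟨g, hg⟩ := hQ k Q hQ' ((hT (k + 1)).exact.lift f hf')
  refine ⟨g, ?_⟩
  exact (Category.assoc _ _ _).symm.trans ((congrArg (· ≫ i (k + 1)) hg).trans
    ((hT (k + 1)).exact.lift_f f hf'))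

lemma IsTotallyAcyclicInj.exists_lift {I : CochainComplex (ModuleCat.{u} S) ℤ}
    (hI : IsTotallyAcyclicInj I) {Q : ModuleCat.{u} S} (hQ : FGInj Q) (j k : ℤ) (hjk : j + 1 = k)
    (f : Q ⟶ I.cycles k) : ∃ g : Q ⟶ I.X j, g ≫ I.toCycles j k = f := by
  obtain rfl : j = k - 1 := by omega
  obtain ⟨g, hg⟩ := hI.hom_exact Q hQ k (f ≫ I.iCycles k)
    (by rw [Category.assoc, I.iCycles_d, Limits.comp_zero])
  refine ⟨g, ?_⟩
  rw [← cancel_mono (I.iCycles k), Category.assoc, I.toCycles_i, hg]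

lemma IsTotallyAcyclicInj.injLink {I : CochainComplex (ModuleCat.{u} S) ℤ}
    (hI : IsTotallyAcyclicInj I) (j : ℤ) : InjLink (I.cycles j) (I.cycles (j + 1)) :=
  ⟨I.X j, I.iCycles j, I.toCycles j (j + 1), _,
    cyclesShortComplex_shortExact hI.acyclic j (j + 1) rfl, hI.fgInj j,
    fun _ hQ f => hI.exists_lift hQ j (j + 1) rfl f⟩

lemma exists_lift_of_acyclic {I : CochainComplex (ModuleCat.{u} S) ℤ}
    (hI : I.Acyclic) (Q : ModuleCat.{u} S) (i j k : ℤ) (hjk : j + 1 = k)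
    (h : ∀ f : Q ⟶ I.cycles j, ∃ g : Q ⟶ I.X i, g ≫ I.toCycles i j = f)
    (f : Q ⟶ I.X j) (hf : f ≫ I.toCycles j k = 0) : ∃ g : Q ⟶ I.X i, g ≫ I.d i j = f := by
  have hT := cyclesShortComplex_shortExact hI j k hjk
  have := hT.mono_f
  obtain ⟨g, hg⟩ := h (hT.exact.lift f hf)
  refine ⟨g, ?_⟩
  rw [← I.toCycles_i, ← Category.assoc, hg]
  exact hT.exact.lift_f f hf

lemma comp_toCycles_eq_zero (I : CochainComplex (ModuleCat.{u} S) ℤ) (Q : ModuleCat.{u} S)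
    (j k : ℤ) (f : Q ⟶ I.X j) (hf : f ≫ I.d j k = 0) : f ≫ I.toCycles j k = 0 := by
  rw [← cancel_mono (I.iCycles k), Category.assoc, I.toCycles_i, hf, Limits.zero_comp]

lemma segmentHomFromExact_of_lift {I : CochainComplex (ModuleCat.{u} S) ℤ}
    (hI : I.Acyclic) (Q : ModuleCat.{u} S)
    (h : ∀ j k : ℤ, j + 1 = k → ∀ f : Q ⟶ I.cycles k, ∃ g : Q ⟶ I.X j, g ≫ I.toCycles j k = f)
    (a b : ℤ) (hab : a < b) : SegmentHomFromExact I a b Q where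
  exact_last := h (b - 1) b (by ring)
  exact_mid j haj hjb f h1 h2 := by
    refine exists_lift_of_acyclic hI Q (j - 1) j (j + 1) rfl (h (j - 1) j (by ring)) f ?_
    rcases (Int.le_sub_one_of_lt hjb).eq_or_lt with h' | h'
    · have := h1 h'
      obtain rfl : b = j + 1 := by omega
      exact this
    · exact comp_toCycles_eq_zero I Q j _ f (h2 h')
  exact_first f h1 h2 := by
    have hT := cyclesShortComplex_shortExact hI a (a + 1) rfl
    have := hT.mono_f
    have hf : f ≫ I.toCycles a (a + 1) = 0 := by
      rcases (Int.le_sub_one_of_lt hab).eq_or_lt with h' | h'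
      · have := h1 h'
        obtain rfl : b = a + 1 := by omega
        exact this
      · exact comp_toCycles_eq_zero I Q a _ f (h2 h')
    exact ⟨hT.exact.lift f hf, hT.exact.lift_f f hf⟩
  exact_start g hg := by
    rwa [← cancel_mono (I.iCycles a), Limits.zero_comp]

lemma IsTotallyAcyclicInj.isNZTotallyAcyclicInj {I : CochainComplex (ModuleCat.{u} S) ℤ}
    (hI : IsTotallyAcyclicInj I) {n : ℕ} (hn : 0 < n) {C : ObjectProperty (ModuleCat.{u} S)}
    (hC : ∀ i : ℤ, C (I.cycles (i * n))) : IsNZTotallyAcyclicInj n C I where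
  acyclic := hI.acyclic
  fgInj := hI.fgInj
  cycles_mem := hC
  hom_exact Q hQ i := by
    have hn' : (0 : ℤ) < n := by exact_mod_cast hn
    exact segmentHomFromExact_of_lift hI.acyclic Q (fun j k hjk f => hI.exists_lift hQ j k hjk f)
      _ _ (by rw [add_mul, one_mul]; exact lt_add_of_pos_right _ hn')

lemma SegmentHomFromExact.exists_lift {I : CochainComplex (ModuleCat.{u} S) ℤ}
    {Q : ModuleCat.{u} S} {a b : ℤ} (h : SegmentHomFromExact I a b Q)
    (ha : ∀ f : Q ⟶ I.cycles a, ∃ g : Q ⟶ I.X (a - 1), g ≫ I.toCycles (a - 1) a = f) (j : ℤ)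
    (haj : a ≤ j) (hjb : j < b) (f : Q ⟶ I.X j) (hf : f ≫ I.d j (j + 1) = 0) :
    ∃ g : Q ⟶ I.X (j - 1), g ≫ I.d (j - 1) j = f := by
  have hlast : j = b - 1 → f ≫ I.toCycles j b = 0 := fun hj => by
    obtain rfl : b = j + 1 := by omega
    exact comp_toCycles_eq_zero I Q j _ f hf
  rcases haj.eq_or_lt with rfl | haj
  · obtain ⟨g, hg⟩ := h.exact_first f hlast fun _ => hf
    obtain ⟨g', hg'⟩ := ha g
    exact ⟨g', by rw [← I.toCycles_i, ← Category.assoc, hg', hg]⟩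
  · exact h.exact_mid j haj hjb f hlast fun _ => hf

lemma IsNZTotallyAcyclicInj.isTotallyAcyclicInj {I : CochainComplex (ModuleCat.{u} S) ℤ}
    {n : ℕ} (hn : 0 < n) {C : ObjectProperty (ModuleCat.{u} S)}
    (hI : IsNZTotallyAcyclicInj n C I) : IsTotallyAcyclicInj I where
  acyclic := hI.acyclic
  fgInj := hI.fgInj
  hom_exact Q hQ j f hf := by
    have hn' : (0 : ℤ) < n := by exact_mod_cast hn
    refine (hI.hom_exact Q hQ (j / n)).exists_lift ?_ j
      (Int.ediv_mul_le j hn'.ne') (Int.lt_ediv_add_one_mul_self j hn') f hf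
    -- Here the gluing takes place at the left end, so the lift comes from the preceding segment.
    have := (hI.hom_exact Q hQ (j / n - 1)).exact_last
    rwa [sub_add_cancel] at this

end Inj
variable {S : Type u} [Ring S]

/-! ### Finite generation and Ext against projectives and injectives. -/

section Finite

lemma finite_of_iso {M N : ModuleCat.{u} S} (e : M ≅ N) (h : Module.Finite S M) :
    Module.Finite S N := Module.Finite.equiv e.toLinearEquiv

variable {T : ShortComplex (ModuleCat.{u} S)}

lemma finite_X₁ [IsNoetherianRing S] (hT : T.ShortExact) (h : Module.Finite S T.X₂) :
    Module.Finite S T.X₁ := by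
  have := hT.mono_f
  exact Module.Finite.of_injective T.f.hom ((ModuleCat.mono_iff_injective _).1 this)

lemma finite_X₃ (hT : T.ShortExact) (h : Module.Finite S T.X₂) : Module.Finite S T.X₃ := by
  have := hT.epi_g
  exact Module.Finite.of_surjective T.g.hom ((ModuleCat.epi_iff_surjective _).1 this)

end Finite

lemma subsingleton_ext_of_fgProj {P : ModuleCat.{u} S} (hP : FGProj P) (Y : ModuleCat.{u} S)
    (i : ℕ) : Subsingleton (Abelian.Ext P Y (i + 1)) := by
  have := hP.2
  exact subsingleton_of_forall_eq 0 Abelian.Ext.eq_zero_of_projective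

lemma subsingleton_ext_of_fgInj {I : ModuleCat.{u} S} (hI : FGInj I) (Y : ModuleCat.{u} S)
    (i : ℕ) : Subsingleton (Abelian.Ext Y I (i + 1)) := by
  have := hI.2
  exact subsingleton_of_forall_eq 0 Abelian.Ext.eq_zero_of_injective

/-! ### Syzygies, cosyzygies and dimension shifting. -/

section Syzygy

lemma shortExact_kernel {M N : ModuleCat.{u} S} (f : M ⟶ N) [Epi f] :
    (ShortComplex.mk _ _ (Limits.kernel.condition f)).ShortExact :=
  { exact := ShortComplex.exact_kernel f }

lemma shortExact_cokernel {M N : ModuleCat.{u} S} (f : M ⟶ N) [Mono f] :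
    (ShortComplex.mk _ _ (Limits.cokernel.condition f)).ShortExact :=
  { exact := ShortComplex.exact_cokernel f }

lemma exists_isSyzygy [IsNoetherianRing S] (k : ℕ) (M : ModuleCat.{u} S)
    (hM : Module.Finite S M) : ∃ K, IsSyzygy k M K := by
  induction k generalizing M with
  | zero => exact ⟨M, ⟨Iso.refl M⟩⟩
  | succ k ih =>
    obtain ⟨P, f, hP, hf⟩ := exists_fgProj_epi M hM
    have hT := shortExact_kernel f
    obtain ⟨K, hK⟩ := ih _ (finite_X₁ hT hP.1)
    exact ⟨K, _, hT, hP, ⟨Iso.refl _⟩, hK⟩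

lemma exists_isCosyzygy (hS : GorensteinLike S) (k : ℕ) (M : ModuleCat.{u} S)
    (hM : Module.Finite S M) : ∃ K, IsCosyzygy k M K := by
  induction k generalizing M with
  | zero => exact ⟨M, ⟨Iso.refl M⟩⟩
  | succ k ih =>
    obtain ⟨I, f, hI, hf⟩ := hS.exists_fgInj_mono M hM
    have hT := shortExact_cokernel f
    obtain ⟨K, hK⟩ := ih _ (finite_X₃ hT hI.1)
    exact ⟨K, _, hT, hI, ⟨Iso.refl _⟩, hK⟩

lemma IsSyzygy.finite [IsNoetherianRing S] {k : ℕ} {M K : ModuleCat.{u} S} (h : IsSyzygy k M K)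
    (hM : Module.Finite S M) : Module.Finite S K := by
  induction k generalizing M with
  | zero => exact finite_of_iso h.some.symm hM
  | succ k ih =>
    obtain ⟨T, hT, hP, -, hK⟩ := h
    exact ih hK (finite_X₁ hT hP.1)

lemma IsCosyzygy.finite {k : ℕ} {M K : ModuleCat.{u} S} (h : IsCosyzygy k M K)
    (hM : Module.Finite S M) : Module.Finite S K := by
  induction k generalizing M with
  | zero => exact finite_of_iso h.some.symm hM
  | succ k ih =>
    obtain ⟨T, hT, hI, -, hK⟩ := h
    exact ih hK (finite_X₃ hT hI.1)

/-- Dimension shifting: `Ext^i(Ω^k M, Y) = 0` if and only if `Ext^{i+k}(M, Y) = 0`, for `i > 0`. -/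
lemma IsSyzygy.subsingleton_ext_iff {k : ℕ} {M K : ModuleCat.{u} S} (h : IsSyzygy k M K)
    (Y : ModuleCat.{u} S) {i : ℕ} (hi : 0 < i) :
    Subsingleton (Abelian.Ext K Y i) ↔ Subsingleton (Abelian.Ext M Y (i + k)) := by
  induction k generalizing M with
  | zero =>
    exact ⟨subsingleton_ext_of_iso_left h.some i, subsingleton_ext_of_iso_left h.some.symm i⟩
  | succ k ih =>
    obtain ⟨T, hT, hP, ⟨e⟩, hK⟩ := h
    rw [ih hK]
    obtain ⟨m, hm⟩ : ∃ m, i + k = m + 1 := ⟨i + k - 1, by omega⟩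
    rw [← add_assoc, hm]
    exact ⟨fun h' => subsingleton_ext_of_iso_left e _ (subsingleton_ext_X₃_left hT Y _ h'
        (subsingleton_ext_of_fgProj hP Y _)),
      fun h' => subsingleton_ext_X₁_left hT Y _ (subsingleton_ext_of_fgProj hP Y _)
        (subsingleton_ext_of_iso_left e.symm _ h')⟩

lemma IsCosyzygy.subsingleton_ext_iff {k : ℕ} {M K : ModuleCat.{u} S} (h : IsCosyzygy k M K)
    (Y : ModuleCat.{u} S) {i : ℕ} (hi : 0 < i) :
    Subsingleton (Abelian.Ext Y K i) ↔ Subsingleton (Abelian.Ext Y M (i + k)) := by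
  induction k generalizing M with
  | zero =>
    exact ⟨subsingleton_ext_of_iso_right h.some i, subsingleton_ext_of_iso_right h.some.symm i⟩
  | succ k ih =>
    obtain ⟨T, hT, hI, ⟨e⟩, hK⟩ := h
    rw [ih hK]
    obtain ⟨m, hm⟩ : ∃ m, i + k = m + 1 := ⟨i + k - 1, by omega⟩
    rw [← add_assoc, hm]
    exact ⟨fun h' => subsingleton_ext_of_iso_right e _ (subsingleton_ext_X₁_right hT Y _ h'
        (subsingleton_ext_of_fgInj hI Y _)),
      fun h' => subsingleton_ext_X₃_right hT Y _ (subsingleton_ext_of_fgInj hI Y _)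
        (subsingleton_ext_of_iso_right e.symm _ h')⟩

/-- If `Ext^{>0}(Z, -)` vanishes on projectives, then `Ext^{i+k}(Z, Ω^k Y) = 0` implies
`Ext^i(Z, Y) = 0`, for `i > 0`. -/
lemma IsSyzygy.subsingleton_ext_of_ext {k : ℕ} {Y K : ModuleCat.{u} S} (h : IsSyzygy k Y K)
    {Z : ModuleCat.{u} S}
    (hZ : ∀ Q : ModuleCat.{u} S, FGProj Q → ∀ i, Subsingleton (Abelian.Ext Z Q (i + 1)))
    {i : ℕ} (hi : 0 < i) (h' : Subsingleton (Abelian.Ext Z K (i + k))) :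
    Subsingleton (Abelian.Ext Z Y i) := by
  induction k generalizing Y i with
  | zero => exact subsingleton_ext_of_iso_right h.some i h'
  | succ k ih =>
    obtain ⟨T, hT, hP, ⟨e⟩, hK⟩ := h
    obtain ⟨m, rfl⟩ : ∃ m, i = m + 1 := ⟨i - 1, by omega⟩
    refine subsingleton_ext_of_iso_right e _ (subsingleton_ext_X₃_right hT Z _ (hZ _ hP _) ?_)
    exact ih hK (by omega) (by rwa [show m + 1 + 1 + k = m + 1 + (k + 1) by omega])

/-- If `Ext^{>0}(-, Z)` vanishes on injectives, then `Ext^{i+k}(Ω^{-k} Y, Z) = 0` implies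
`Ext^i(Y, Z) = 0`, for `i > 0`. -/
lemma IsCosyzygy.subsingleton_ext_of_ext {k : ℕ} {Y K : ModuleCat.{u} S} (h : IsCosyzygy k Y K)
    {Z : ModuleCat.{u} S}
    (hZ : ∀ Q : ModuleCat.{u} S, FGInj Q → ∀ i, Subsingleton (Abelian.Ext Q Z (i + 1)))
    {i : ℕ} (hi : 0 < i) (h' : Subsingleton (Abelian.Ext K Z (i + k))) :
    Subsingleton (Abelian.Ext Y Z i) := by
  induction k generalizing Y i with
  | zero => exact subsingleton_ext_of_iso_left h.some i h'
  | succ k ih =>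
    obtain ⟨T, hT, hI, ⟨e⟩, hK⟩ := h
    obtain ⟨m, rfl⟩ : ∃ m, i = m + 1 := ⟨i - 1, by omega⟩
    refine subsingleton_ext_of_iso_left e _ (subsingleton_ext_X₁_left hT Z _ (hZ _ hI _) ?_)
    exact ih hK (by omega) (by rwa [show m + 1 + 1 + k = m + 1 + (k + 1) by omega])

end Syzygy

/-! ### Ext and syzygies along a chain of links. -/

section Chain

variable {Z : ℤ → ModuleCat.{u} S}

/-- Degree one is the extension property of a link; a higher degree shifts down to the previous term
of the chain. -/
lemma subsingleton_ext_of_projLink (h : ∀ j, ProjLink (Z j) (Z (j + 1))) (Q : ModuleCat.{u} S)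
    (hQ : FGProj Q) (k : ℕ) (j : ℤ) : Subsingleton (Abelian.Ext (Z j) Q (k + 1)) := by
  obtain ⟨j, rfl⟩ : ∃ m, j = m + 1 := ⟨j - 1, by ring⟩
  induction k generalizing j with
  | zero =>
    obtain ⟨X, i, p, w, hT, hX, hl⟩ := h j
    exact subsingleton_ext_one_of_extension hT Q (subsingleton_ext_of_fgProj hX Q 0) (hl Q hQ)
  | succ k ih =>
    obtain ⟨X, i, p, w, hT, hX, -⟩ := h j
    have := ih (j - 1)
    rw [sub_add_cancel] at this
    exact subsingleton_ext_X₃_left hT Q _ this (subsingleton_ext_of_fgProj hX Q _)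

lemma subsingleton_ext_of_injLink (h : ∀ j, InjLink (Z j) (Z (j + 1))) (Q : ModuleCat.{u} S)
    (hQ : FGInj Q) (k : ℕ) (j : ℤ) : Subsingleton (Abelian.Ext Q (Z j) (k + 1)) := by
  induction k generalizing j with
  | zero =>
    obtain ⟨X, i, p, w, hT, hX, hl⟩ := h j
    exact subsingleton_ext_one_of_lift hT Q (subsingleton_ext_of_fgInj hX Q 0) (hl Q hQ)
  | succ k ih =>
    obtain ⟨X, i, p, w, hT, hX, -⟩ := h j
    exact subsingleton_ext_X₁_right hT Q _ (ih (j + 1)) (subsingleton_ext_of_fgInj hX Q _)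

lemma isSyzygy_of_projLink (h : ∀ j, ProjLink (Z j) (Z (j + 1))) (k : ℕ) (j : ℤ) :
    IsSyzygy k (Z (j + k)) (Z j) := by
  induction k with
  | zero => exact ⟨eqToIso (by simp)⟩
  | succ k ih =>
    obtain ⟨X, i, p, w, hT, hX, -⟩ := h (j + k)
    exact ⟨_, hT, hX, ⟨eqToIso (by push_cast; rw [add_assoc])⟩, ih⟩

lemma isCosyzygy_of_injLink (h : ∀ j, InjLink (Z j) (Z (j + 1))) (k : ℕ) (j : ℤ) :
    IsCosyzygy k (Z j) (Z (j + k)) := by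
  induction k generalizing j with
  | zero => exact ⟨eqToIso (by simp)⟩
  | succ k ih =>
    obtain ⟨X, i, p, w, hT, hX, -⟩ := h j
    refine ⟨_, hT, hX, ⟨Iso.refl _⟩, ?_⟩
    have := ih (j + 1)
    rwa [add_assoc, add_comm (1 : ℤ), ← Nat.cast_succ] at this

lemma finite_of_projLink (h : ∀ j, ProjLink (Z j) (Z (j + 1))) (j : ℤ) :
    Module.Finite S (Z j) := by
  obtain ⟨j, rfl⟩ : ∃ m, j = m + 1 := ⟨j - 1, by ring⟩
  obtain ⟨X, i, p, w, hT, hX, -⟩ := h j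
  exact finite_X₃ hT hX.1

lemma finite_of_injLink (h : ∀ j, InjLink (Z j) (Z (j + 1))) (j : ℤ) :
    Module.Finite S (Z j) := by
  obtain ⟨j, rfl⟩ : ∃ m, j = m + 1 := ⟨j - 1, by ring⟩
  obtain ⟨X, i, p, w, hT, hX, -⟩ := h j
  exact finite_X₃ hT hX.1

end Chain

/-! ### Cluster tilting subcategories and Gorenstein modules. -/

section ClusterTilting

variable {n : ℕ} {C : ObjectProperty (ModuleCat.{u} S)}

lemma not_dvd_add_mul {n i m : ℕ} (hi : 0 < i) (hin : i < n) : ¬ n ∣ i + m * n := fun h =>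
  absurd (Nat.le_of_dvd hi ((Nat.dvd_add_left (Dvd.intro_left m rfl)).1 h)) (by omega)

namespace IsClusterTilting

variable (hC : IsClusterTilting n C)
include hC

lemma mem_iff_right (X : ModuleCat.{u} S) : C X ↔ rightPerp n C X :=
  iff_of_eq (congrFun hC.eq_rightPerp X)

lemma mem_iff_left (X : ModuleCat.{u} S) : C X ↔ leftPerp n C X :=
  iff_of_eq (congrFun hC.eq_leftPerp X)

lemma finite {X : ModuleCat.{u} S} (hX : C X) : Module.Finite S X :=
  ((hC.mem_iff_left X).1 hX).1

lemma mem_of_iso {X Y : ModuleCat.{u} S} (e : X ≅ Y) (hX : C X) : C Y := by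
  rw [hC.mem_iff_left] at hX ⊢
  exact ⟨finite_of_iso e hX.1, fun W hW i hi hin =>
    subsingleton_ext_of_iso_left e i (hX.2 W hW i hi hin)⟩

end IsClusterTilting

namespace IsNZClusterTilting

variable (hC : IsNZClusterTilting n C)
include hC

/-- `Ext^i(Ω^{mn} X, Y)` is governed by `Ext^{i+mn}(X, Y)`, and `i + mn` is not divisible by `n` for
`0 < i < n`. -/
lemma mem_of_isSyzygy [IsNoetherianRing S] {m : ℕ} {X K : ModuleCat.{u} S} (hX : C X)
    (hK : IsSyzygy (m * n) X K) : C K :=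
  (hC.mem_iff_left K).2 ⟨hK.finite (hC.finite hX), fun Y hY _ hi hin =>
    (hK.subsingleton_ext_iff Y hi).2 (hC.ext_vanish X Y hX hY _ (not_dvd_add_mul hi hin))⟩

lemma mem_of_isCosyzygy {m : ℕ} {X K : ModuleCat.{u} S} (hX : C X)
    (hK : IsCosyzygy (m * n) X K) : C K :=
  (hC.mem_iff_right K).2 ⟨hK.finite (hC.finite hX), fun Y hY _ hi hin =>
    (hK.subsingleton_ext_iff Y hi).2 (hC.ext_vanish Y X hY hX _ (not_dvd_add_mul hi hin))⟩

/-- Downwards the terms are `n`-th syzygies. Upwards, shift both arguments: since the terms are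
Ext-orthogonal to projectives, `Ext^k(Z^{(i+1)n}, Y)` vanishes once `Ext^{k+n}(Z^{(i+1)n}, Ω^n Y)`
does, and this reduces to `Ext^k(Z^{in}, Ω^n Y)`, where `Ω^n Y` is again in `C`. -/
lemma mem_of_projLink [IsNoetherianRing S] {Z : ℤ → ModuleCat.{u} S}
    (h : ∀ j, ProjLink (Z j) (Z (j + 1))) (h0 : C (Z 0)) (i : ℤ) : C (Z (i * n)) := by
  induction i using Int.induction_on with
  | zero => rwa [zero_mul]
  | succ i ih =>
    rw [add_mul, one_mul]
    have hs := isSyzygy_of_projLink h n (i * n)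
    refine (hC.mem_iff_left _).2 ⟨finite_of_projLink h _, fun Y hY k hk hkn => ?_⟩
    obtain ⟨K, hK⟩ := exists_isSyzygy n Y (hC.finite hY)
    have hK' : C K := hC.mem_of_isSyzygy (m := 1) hY (by rwa [one_mul])
    exact hK.subsingleton_ext_of_ext (fun Q hQ l => subsingleton_ext_of_projLink h Q hQ l _) hk
      ((hs.subsingleton_ext_iff K hk).1 (((hC.mem_iff_left _).1 ih).2 K hK' k hk hkn))
  | pred i ih =>
    refine hC.mem_of_isSyzygy (m := 1) ih ?_
    have := isSyzygy_of_projLink h n ((-(i : ℤ) - 1) * n)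
    rw [show (-(i : ℤ) - 1) * n + n = -(i : ℤ) * n by ring] at this
    rwa [one_mul]

lemma mem_of_injLink (hS : GorensteinLike S) {Z : ℤ → ModuleCat.{u} S}
    (h : ∀ j, InjLink (Z j) (Z (j + 1))) (h0 : C (Z 0)) (i : ℤ) : C (Z (i * n)) := by
  induction i using Int.induction_on with
  | zero => rwa [zero_mul]
  | succ i ih =>
    rw [add_mul, one_mul]
    refine hC.mem_of_isCosyzygy (m := 1) ih ?_
    rw [one_mul]
    exact isCosyzygy_of_injLink h n (i * n)
  | pred i ih =>
    have hs := isCosyzygy_of_injLink h n ((-(i : ℤ) - 1) * n)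
    rw [show (-(i : ℤ) - 1) * n + n = -(i : ℤ) * n by ring] at hs
    refine (hC.mem_iff_right _).2 ⟨finite_of_injLink h _, fun Y hY k hk hkn => ?_⟩
    obtain ⟨K, hK⟩ := exists_isCosyzygy hS n Y (hC.finite hY)
    have hK' : C K := hC.mem_of_isCosyzygy (m := 1) hY (by rwa [one_mul])
    exact hK.subsingleton_ext_of_ext (fun Q hQ l => subsingleton_ext_of_injLink h Q hQ l _) hk
      ((hs.subsingleton_ext_iff K hk).1 (((hC.mem_iff_right _).1 ih).2 K hK' k hk hkn))

theorem nzGprj_eq [IsNoetherianRing S] (hn : 0 < n) : NZGprj n C = Gprj ⊓ C := by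
  ext G
  constructor
  · rintro ⟨hG, P, hP, i, ⟨e⟩⟩
    refine ⟨?_, hG⟩
    have hl := (hP.isTotallyAcyclicProj hn).projLink
    -- `Gprj` is defined through degree `0`, so the chain is reindexed to start at `i * n` and
    -- spliced again.
    obtain ⟨P', hP', ⟨e'⟩⟩ := gprj_of_projLink (fun j => P.cycles (i * n + j)) fun j => by
      rw [← add_assoc]; exact hl _
    exact ⟨P', hP', ⟨e ≪≫ eqToIso (by simp) ≪≫ e'⟩⟩
  · rintro ⟨⟨P, hP, ⟨e⟩⟩, hG⟩
    have h0 := hC.mem_of_iso e hG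
    exact ⟨hG, P, hP.isNZTotallyAcyclicProj hn (hC.mem_of_projLink hP.projLink h0), 0,
      ⟨e ≪≫ eqToIso (by simp only [zero_mul])⟩⟩

theorem nzGinj_eq (hS : GorensteinLike S) (hn : 0 < n) : NZGinj n C = Ginj ⊓ C := by
  ext G
  constructor
  · rintro ⟨hG, P, hP, i, ⟨e⟩⟩
    refine ⟨?_, hG⟩
    have hl := (hP.isTotallyAcyclicInj hn).injLink
    obtain ⟨P', hP', ⟨e'⟩⟩ := ginj_of_injLink (fun j => P.cycles (i * n + j)) fun j => by
      rw [← add_assoc]; exact hl _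
    exact ⟨P', hP', ⟨e ≪≫ eqToIso (by simp) ≪≫ e'⟩⟩
  · rintro ⟨⟨P, hP, ⟨e⟩⟩, hG⟩
    have h0 := hC.mem_of_iso e hG
    exact ⟨hG, P, hP.isNZTotallyAcyclicInj hn (hC.mem_of_injLink hS hP.injLink h0), 0,
      ⟨e ≪≫ eqToIso (by simp only [zero_mul])⟩⟩

end IsNZClusterTilting

end ClusterTilting

/-! ### Ext-orthogonal modules are Gorenstein projective, resp. injective. -/

section Gorenstein

/-- Finitely generated modules `K` with `Ext^{>0}(K, Q) = 0` for all finitely generated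
projective `Q`. -/
def ProjOrthogonal (K : ModuleCat.{u} S) : Prop :=
  Module.Finite S K ∧ ∀ Q : ModuleCat.{u} S, FGProj Q → ∀ i, Subsingleton (Abelian.Ext K Q (i + 1))

/-- Finitely generated modules `K` with `Ext^{>0}(Q, K) = 0` for all finitely generated
injective `Q`. -/
def InjOrthogonal (K : ModuleCat.{u} S) : Prop :=
  Module.Finite S K ∧ ∀ Q : ModuleCat.{u} S, FGInj Q → ∀ i, Subsingleton (Abelian.Ext Q K (i + 1))

namespace ProjOrthogonal

variable {K : ModuleCat.{u} S} (hK : ProjOrthogonal K)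
include hK

lemma exists_projLink_left [IsNoetherianRing S] : ∃ L, ProjOrthogonal L ∧ ProjLink L K := by
  obtain ⟨P, f, hP, hf⟩ := exists_fgProj_epi K hK.1
  have hT := shortExact_kernel f
  exact ⟨_, ⟨finite_X₁ hT hP.1, fun Q hQ i => subsingleton_ext_X₁_left hT Q _
    (subsingleton_ext_of_fgProj hP Q i) (hK.2 Q hQ (i + 1))⟩, P, _, f, _, hT, hP,
    fun Q hQ g => exists_extension hT Q (hK.2 Q hQ 0) g⟩

lemma subsingleton_ext_of_projDim [IsNoetherianRing S] (d : ℕ) (L : ModuleCat.{u} S)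
    (hL : Module.Finite S L) (h : HasProjectiveDimensionLT L (d + 1)) (i : ℕ) :
    Subsingleton (Abelian.Ext K L (i + 1)) := by
  induction d generalizing L i with
  | zero => exact hK.2 L ⟨hL, projective_iff_hasProjectiveDimensionLT_one.2 h⟩ i
  | succ d ih =>
    obtain ⟨P, f, hP, hf⟩ := exists_fgProj_epi L hL
    have hT := shortExact_kernel f
    exact subsingleton_ext_X₃_right hT K _ (hK.2 P hP i)
      (ih _ (finite_X₁ hT hP.1) ((hT.hasProjectiveDimensionLT_X₃_iff d hP.2).1 h) (i + 1))

/-- The kernel of `P ⟶ I` has finite projective dimension because `I` does, so `Ext^1(K, -)` kills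
it and the embedding of `K` in `I` lifts to `P`. -/
lemma exists_fgProj_mono (hS : GorensteinLike S) :
    ∃ (P : ModuleCat.{u} S) (f : K ⟶ P), FGProj P ∧ Mono f := by
  have := hS.noetherian
  obtain ⟨d, hd⟩ := hS.exists_projDim_le
  obtain ⟨I, f, hI, hf⟩ := hS.exists_fgInj_mono K hK.1
  obtain ⟨P, p, hP, hp⟩ := exists_fgProj_epi I hI.1
  have hT := shortExact_kernel p
  have hI' := hd I hI
  have hL : HasProjectiveDimensionLT (Limits.kernel p) (d + 1) :=
    (hT.hasProjectiveDimensionLT_X₃_iff d hP.2).1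
      (hasProjectiveDimensionLT_of_ge I (d + 1) _ (by omega))
  obtain ⟨g, hg⟩ := exists_lift hT K
    (hK.subsingleton_ext_of_projDim d _ (finite_X₁ hT hP.1) hL 0) f
  have : Mono (g ≫ p) := by rw [show g ≫ p = f from hg]; exact hf
  exact ⟨P, g, hP, mono_of_mono g p⟩

/-- Some embedding of `K` in a projective factors through the left approximation, which is therefore
mono. The approximation property is exactly the vanishing of `Ext^1` from the cokernel to
projectives. -/
lemma exists_projLink_right (hS : GorensteinLike S) :
    ∃ L, ProjOrthogonal L ∧ ProjLink K L := by
  obtain ⟨P, f, hP, hl⟩ := hS.exists_left_approx K hK.1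
  obtain ⟨P', f', hP', hf'⟩ := hK.exists_fgProj_mono hS
  obtain ⟨h, rfl⟩ := hl P' f' hP'
  have : Mono f := mono_of_mono f h
  have hT := shortExact_cokernel f
  refine ⟨_, ⟨finite_X₃ hT hP.1, fun Q hQ i => ?_⟩, P, f, _, _, hT, hP,
    fun Q hQ g => hl Q g hQ⟩
  cases i with
  | zero =>
    exact subsingleton_ext_one_of_extension hT Q (subsingleton_ext_of_fgProj hP Q 0)
      fun g => hl Q g hQ
  | succ i =>
    exact subsingleton_ext_X₃_left hT Q _ (hK.2 Q hQ i) (subsingleton_ext_of_fgProj hP Q _)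

theorem gprj (hS : GorensteinLike S) : Gprj K := by
  have := hS.noetherian
  obtain ⟨Z, hZ, hl⟩ := exists_int_chain
    (α := {K : ModuleCat.{u} S // ProjOrthogonal K}) (fun A B => ProjLink A.1 B.1)
    (fun A => by obtain ⟨L, hL, h⟩ := A.2.exists_projLink_right hS; exact ⟨⟨L, hL⟩, h⟩)
    (fun A => by obtain ⟨L, hL, h⟩ := A.2.exists_projLink_left; exact ⟨⟨L, hL⟩, h⟩) ⟨K, hK⟩
  have := gprj_of_projLink (fun j => (Z j).1) hl
  rwa [hZ] at this

end ProjOrthogonal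

namespace InjOrthogonal

variable {K : ModuleCat.{u} S} (hK : InjOrthogonal K)
include hK

lemma exists_injLink_right (hS : GorensteinLike S) : ∃ L, InjOrthogonal L ∧ InjLink K L := by
  obtain ⟨I, f, hI, hf⟩ := hS.exists_fgInj_mono K hK.1
  have hT := shortExact_cokernel f
  exact ⟨_, ⟨finite_X₃ hT hI.1, fun Q hQ i => subsingleton_ext_X₃_right hT Q _
    (subsingleton_ext_of_fgInj hI Q i) (hK.2 Q hQ (i + 1))⟩, I, f, _, _, hT, hI,
    fun Q hQ g => exists_lift hT Q (hK.2 Q hQ 0) g⟩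

lemma subsingleton_ext_of_injDim (hS : GorensteinLike S) (d : ℕ) (L : ModuleCat.{u} S)
    (hL : Module.Finite S L) (h : HasInjectiveDimensionLT L (d + 1)) (i : ℕ) :
    Subsingleton (Abelian.Ext L K (i + 1)) := by
  induction d generalizing L i with
  | zero => exact hK.2 L ⟨hL, injective_iff_hasInjectiveDimensionLT_one.2 h⟩ i
  | succ d ih =>
    obtain ⟨I, f, hI, hf⟩ := hS.exists_fgInj_mono L hL
    have hT := shortExact_cokernel f
    exact subsingleton_ext_X₁_left hT K _ (hK.2 I hI i)
      (ih _ (finite_X₃ hT hI.1) ((hT.hasInjectiveDimensionLT_X₃_iff d hI.2).2 h) (i + 1))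

/-- Dually, embed a projective `P` covering `K` in an injective `I`; the cokernel has finite
injective dimension, so `P ⟶ K` extends to `I`. -/
lemma exists_fgInj_epi (hS : GorensteinLike S) :
    ∃ (I : ModuleCat.{u} S) (f : I ⟶ K), FGInj I ∧ Epi f := by
  obtain ⟨d, hd⟩ := hS.exists_injDim_le
  obtain ⟨P, f, hP, hf⟩ := exists_fgProj_epi K hK.1
  obtain ⟨I, p, hI, hp⟩ := hS.exists_fgInj_mono P hP.1
  have hT := shortExact_cokernel p
  have hP' := hd P hP
  have hL : HasInjectiveDimensionLT (Limits.cokernel p) (d + 1) :=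
    (hT.hasInjectiveDimensionLT_X₃_iff d hI.2).2
      (hasInjectiveDimensionLT_of_ge P (d + 1) _ (by omega))
  obtain ⟨g, hg⟩ := exists_extension hT K
    (hK.subsingleton_ext_of_injDim hS d _ (finite_X₃ hT hI.1) hL 0) f
  have : Epi (p ≫ g) := by rw [show p ≫ g = f from hg]; exact hf
  exact ⟨I, g, hI, epi_of_epi p g⟩

lemma exists_injLink_left (hS : GorensteinLike S) :
    ∃ L, InjOrthogonal L ∧ InjLink L K := by
  have := hS.noetherian
  obtain ⟨I, f, hI, hl⟩ := hS.exists_right_approx K hK.1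
  obtain ⟨I', f', hI', hf'⟩ := hK.exists_fgInj_epi hS
  obtain ⟨h, rfl⟩ := hl I' f' hI'
  have : Epi f := epi_of_epi h f
  have hT := shortExact_kernel f
  refine ⟨_, ⟨finite_X₁ hT hI.1, fun Q hQ i => ?_⟩, I, _, f, _, hT, hI,
    fun Q hQ g => hl Q g hQ⟩
  cases i with
  | zero =>
    exact subsingleton_ext_one_of_lift hT Q (subsingleton_ext_of_fgInj hI Q 0)
      fun g => hl Q g hQ
  | succ i =>
    exact subsingleton_ext_X₁_right hT Q _ (hK.2 Q hQ i) (subsingleton_ext_of_fgInj hI Q _)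

theorem ginj (hS : GorensteinLike S) : Ginj K := by
  obtain ⟨Z, hZ, hl⟩ := exists_int_chain
    (α := {K : ModuleCat.{u} S // InjOrthogonal K}) (fun A B => InjLink A.1 B.1)
    (fun A => by obtain ⟨L, hL, h⟩ := A.2.exists_injLink_right hS; exact ⟨⟨L, hL⟩, h⟩)
    (fun A => by obtain ⟨L, hL, h⟩ := A.2.exists_injLink_left hS; exact ⟨⟨L, hL⟩, h⟩) ⟨K, hK⟩
  have := ginj_of_injLink (fun j => (Z j).1) hl
  rwa [hZ] at this

end InjOrthogonal

lemma IsSyzygy.projOrthogonal [IsNoetherianRing S] {k d : ℕ} (hdk : d ≤ k)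
    {M K : ModuleCat.{u} S} (h : IsSyzygy k M K) (hM : Module.Finite S M)
    (hd : ∀ Q : ModuleCat.{u} S, FGProj Q → HasInjectiveDimensionLT Q (d + 1)) :
    ProjOrthogonal K :=
  ⟨h.finite hM, fun Q hQ i => by
    have := hd Q hQ
    rw [h.subsingleton_ext_iff Q (Nat.succ_pos i)]
    exact HasInjectiveDimensionLT.subsingleton Q (d + 1) _ (by omega) M⟩

lemma IsCosyzygy.injOrthogonal {k d : ℕ} (hdk : d ≤ k)
    {M K : ModuleCat.{u} S} (h : IsCosyzygy k M K) (hM : Module.Finite S M)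
    (hd : ∀ Q : ModuleCat.{u} S, FGInj Q → HasProjectiveDimensionLT Q (d + 1)) :
    InjOrthogonal K :=
  ⟨h.finite hM, fun Q hQ i => by
    have := hd Q hQ
    rw [h.subsingleton_ext_iff Q (Nat.succ_pos i)]
    exact HasProjectiveDimensionLT.subsingleton Q (d + 1) _ (by omega) M⟩

variable {n : ℕ} {C : ObjectProperty (ModuleCat.{u} S)}

theorem IsNZClusterTilting.isNZGClusterTilting (hS : GorensteinLike S) (hn : 0 < n)
    (hC : IsNZClusterTilting n C) : IsNZGClusterTilting n C := by
  have := hS.noetherian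
  obtain ⟨d, hd⟩ := hS.exists_injDim_le
  obtain ⟨e, he⟩ := hS.exists_projDim_le
  -- The dimension bounds `d` and `e` themselves serve as indices, since `d ≤ d * n` and `e ≤ e *
  -- n`.
  refine ⟨{ hC with exists_syzygy := fun X hX => ⟨d, ?_, fun K hK => ?_⟩ },
    { hC with exists_cosyzygy := fun X hX => ⟨e, ?_, fun K hK => ?_⟩ }⟩
  · exact exists_isSyzygy _ X (hC.finite hX)
  · rw [hC.nzGprj_eq hn]
    exact ⟨(hK.projOrthogonal (Nat.le_mul_of_pos_right d hn) (hC.finite hX) hd).gprj hS,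
      hC.mem_of_isSyzygy hX hK⟩
  · exact exists_isCosyzygy hS _ X (hC.finite hX)
  · rw [hC.nzGinj_eq hS hn]
    exact ⟨(hK.injOrthogonal (Nat.le_mul_of_pos_right e hn) (hC.finite hX) he).ginj hS,
      hC.mem_of_isCosyzygy hX hK⟩

end Gorenstein

end NZGorenstein

theorem proposition3p9 {R : Type*} [CommRing R] [IsArtinianRing R]
    {Λ : Type u} [Ring Λ] [Algebra R Λ] [Module.Finite R Λ]
    (hΛ : NZGorenstein.IsIwanagaGorenstein Λ)
    (n : ℕ) (hn : 0 < n)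
    (C : ObjectProperty (ModuleCat.{u} Λᵐᵒᵖ)) (hC : NZGorenstein.IsNZClusterTilting n C) :
    NZGorenstein.IsNZGClusterTilting n C ∧
      NZGorenstein.NZGprj n C = NZGorenstein.Gprj ⊓ C ∧
      NZGorenstein.NZGinj n C = NZGorenstein.Ginj ⊓ C := by
  have hS := NZGorenstein.gorensteinLike (R := R) hΛ
  have := hS.noetherian
  exact ⟨hC.isNZGClusterTilting hS hn, hC.nzGprj_eq hn, hC.nzGinj_eq hS hn⟩
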